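/- Let $(\lambda_k)_{k\ge 1}$ be a summable sequence of real numbers with tail sums $R_n=\sum_{k>n}\lambda_k$, and assume that $\lambda_n>R_n>0$ for every $n\ge1$. Let $C^\lambda(t)=\prod_{k\ge1}\cos(\lambda_k t)$ for $t\in\mathbb R$, and let $\mu^\lambda$ be the symmetric Bernoulli convolution, that is, the law of $\sum_{k\ge1}\lambda_k\varepsilon_k$, where the $\varepsilon_k$ are i.i.d. with $\mathbb P(\varepsilon_k=1)=\mathbb P(\varepsilon_k=-1)=\tfrac12$. Then: 1. $\mu^\lambda$ has characteristic function $C^\lambda$ (so it is the spectral measure of the process $\mathsf X^\lambda$ below), and it has no atoms. 2. The support of $\mu^\lambda$ has Cantor type: it is compact, totally disconnected and without isolated points. 3. $\displaystyle\lim_{T\to\infty}\frac1T\int_0^T C^\lambda(t)\,dt=0.$ 4. Let $\mathsf X^\lambda$ be a centred stationary Gaussian process on $\mathbb R$, defined on some probability space, with $\mathrm{Cov}(\mathsf X^\lambda(s),\mathsf X^\lambda(t))=C^\lambda(s-t)$ for all $s,t\in\mathbb R$ and with almost surely continuous paths. Then $\mathsf X^\lambda$ is weakly mixing: for all measurable sets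 $A,B$ in the product $\sigma$-algebra of $\mathbb R^{\mathbb R}$, $$\lim_{T\to\infty}\frac1T\int_0^T\bigl|\mathbb P(\mathsf X^\lambda\in A,\ \mathsf X^\lambda(\cdot+t)\in B)-\mathbb P(\mathsf X^\lambda\in A)\,\mathbb P(\mathsf X^\lambda\in B)\bigr|\,dt=0.$$ 5. For $\mathsf X^\lambda$ as in 4, the zero set $\mathsf Z^\lambda=\{t\in\mathbb R:\mathsf X^\lambda(t)=0\}$ is almost surely locally finite. It is (after modification on a null set) a stationary point process, i.e. a random element of the space $\mathscr N(\mathbb R)$ of locally finite subsets of $\mathbb R$ with the $\sigma$-algebra $\mathscr B(\mathscr N(\mathbb R))$ generated by the maps $\mathsf Z\mapsto\#(\mathsf Z\cap A)$, $A\subset\mathbb R$ Borel. It is weakly mixing: for all $A,B\in\mathscr B(\mathscr N(\mathbb R))$, $$\lim_{T\to\infty}\frac1T\int_0^T\bigl|\mathbb P(\mathsf Z^\lambda\in A,\ \mathsf Z^\lambda+t\in B)-\mathbb P(\mathsf Z^\lambda\in A)\,\mathbb P(\mathsf Z^\lambda\in B)\bigr|\,dt=0.$$ -/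

import Mathlib

open MeasureTheory ProbabilityTheory Filter Topology

noncomputable section

/-! Symmetric Bernoulli convolutions. The coefficients are indexed from `0`. -/

/-- The tail sum `R_n = ∑_{k > n} λ_k`. -/
def tailSum (lam : ℕ → ℝ) (n : ℕ) : ℝ := ∑' k : ℕ, lam (n + 1 + k)

/-- The infinite product `C^λ(t) = ∏_k cos (λ_k t)`. -/
def bernoulliCov (lam : ℕ → ℝ) (t : ℝ) : ℝ := ∏' k : ℕ, Real.cos (lam k * t)

/-- The sign attached to the outcome of a coin toss. -/
def coinSign (b : Bool) : ℝ := if b then 1 else -1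

/-- The law of a sequence of independent fair coin tosses. Under it, the random variables
`e ↦ coinSign (e k)` are independent Rademacher variables. -/
def coinTossing : Measure (ℕ → Bool) :=
  Measure.infinitePi fun _ : ℕ => (PMF.uniformOfFintype Bool).toMeasure

/-- The random variable `Y^λ = ∑_k λ_k ε_k`; the series converges absolutely for a summable `λ`. -/
def bernoulliSum (lam : ℕ → ℝ) (e : ℕ → Bool) : ℝ := ∑' k : ℕ, lam k * coinSign (e k)

/-- The symmetric Bernoulli convolution `μ^λ`: the law of `∑_k λ_k ε_k`. -/
def bernoulliConvolution (lam : ℕ → ℝ) : Measure ℝ := coinTossing.map (bernoulliSum lam)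

/-- Sets of Cantor type: compact, totally disconnected, and without isolated points. -/
def IsCantorType (S : Set ℝ) : Prop := IsCompact S ∧ IsTotallyDisconnected S ∧ Preperfect S

/-- The averages `T⁻¹ ∫₀ᵀ f(t) dt` make sense and tend to `0` as `T → ∞`. -/
def CesaroTendstoZero (f : ℝ → ℝ) : Prop :=
  (∀ T : ℝ, IntervalIntegrable f volume 0 T) ∧
    Tendsto (fun T : ℝ => T⁻¹ * ∫ t in (0 : ℝ)..T, f t) atTop (𝓝 0)

/-! Stationary Gaussian processes and weak mixing. -/

/-- `X` is a (centred) stationary Gaussian process on the real line with reduced covariance `C`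
and with almost surely continuous paths. -/
structure IsStationaryGaussian {Ω : Type*} [MeasurableSpace Ω] (X : ℝ → Ω → ℝ) (P : Measure Ω)
    (C : ℝ → ℝ) : Prop where
  measurable : ∀ t, Measurable (X t)
  gaussian : IsGaussianProcess X P
  centred : ∀ t, ∫ ω, X t ω ∂P = 0
  covariance_eq : ∀ s t, covariance (X s) (X t) P = C (s - t)
  continuous_paths : ∀ᵐ ω ∂P, Continuous fun t => X t ω

/-- The process `X` is stationary and weakly mixing. The events of `σ(X)` are the sets `{X ∈ A}` with
`A` in the product `σ`-algebra of `ℝ → ℝ`, and the translate by `t` of the event `{X ∈ B}` is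
`{X(· + t) ∈ B}`. -/
structure IsWeaklyMixingProcess {Ω : Type*} [MeasurableSpace Ω] (X : ℝ → Ω → ℝ)
    (P : Measure Ω) : Prop where
  stationary : ∀ t : ℝ, P.map (fun ω s => X (s + t) ω) = P.map (fun ω s => X s ω)
  mixing : ∀ A B : Set (ℝ → ℝ), MeasurableSet A → MeasurableSet B →
    CesaroTendstoZero fun t =>
      |P.real {ω | (fun s => X s ω) ∈ A ∧ (fun s => X (s + t) ω) ∈ B}
        - P.real {ω | (fun s => X s ω) ∈ A} * P.real {ω | (fun s => X s ω) ∈ B}|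

/-! Point processes on the real line. -/

/-- A set of reals is locally finite if it has finitely many points in each bounded interval. -/
def IsLocallyFiniteSet (S : Set ℝ) : Prop := ∀ a b : ℝ, (S ∩ Set.Icc a b).Finite

/-- The space of locally finite subsets of the real line. -/
def Configuration : Type := {S : Set ℝ // IsLocallyFiniteSet S}

/-- The number of points of a configuration in a set. -/
def Configuration.count (A : Set ℝ) (Z : Configuration) : ℕ∞ := (Z.1 ∩ A).encard

/-- The `σ`-algebra generated by the counting maps `Z ↦ #(Z ∩ A)`, `A` Borel. -/
instance Configuration.instMeasurableSpace : MeasurableSpace Configuration :=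
  ⨆ (A : Set ℝ) (_ : MeasurableSet A), MeasurableSpace.comap (Configuration.count A) ⊤

theorem isLocallyFiniteSet_translate {S : Set ℝ} (hS : IsLocallyFiniteSet S) (t : ℝ) :
    IsLocallyFiniteSet ((fun x => x + t) '' S) := by
  intro a b
  refine ((hS (a - t) (b - t)).image fun x => x + t).subset ?_
  rintro _ ⟨⟨x, hx, rfl⟩, hab⟩
  exact ⟨x, ⟨hx, by linarith [hab.1], by linarith [hab.2]⟩, rfl⟩

/-- The translate `Z + t` of a configuration. -/
def Configuration.translate (t : ℝ) (Z : Configuration) : Configuration :=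
  ⟨(fun x => x + t) '' Z.1, isLocallyFiniteSet_translate Z.2 t⟩

/-- The random configuration `Z` is a stationary and weakly mixing point process. -/
structure IsWeaklyMixingPointProcess {Ω : Type*} [MeasurableSpace Ω] (Z : Ω → Configuration)
    (P : Measure Ω) : Prop where
  aemeasurable : AEMeasurable Z P
  stationary : ∀ t : ℝ, P.map (fun ω => (Z ω).translate t) = P.map Z
  mixing : ∀ A B : Set Configuration, MeasurableSet A → MeasurableSet B →
    CesaroTendstoZero fun t =>
      |P.real {ω | Z ω ∈ A ∧ (Z ω).translate t ∈ B} - P.real {ω | Z ω ∈ A} * P.real {ω | Z ω ∈ B}|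

/-- The set of zeros of the path `t ↦ X t ω`. -/
def zeroSet {Ω : Type*} (X : ℝ → Ω → ℝ) (ω : Ω) : Set ℝ := {t | X t ω = 0}

open Classical in
/-- The zero set as a configuration, with the empty configuration as the value at those `ω` for
which the zero set is not locally finite. -/
def zeroConfiguration {Ω : Type*} (X : ℝ → Ω → ℝ) (ω : Ω) : Configuration :=
  if h : IsLocallyFiniteSet (zeroSet X ω) then ⟨zeroSet X ω, h⟩ else ⟨∅, by intro a b; simp⟩

end

/-! ### The law of a random signed sum -/

/-! Since `lam n` exceeds the tail after it, a signed sum determines its signs: at the first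
disagreement the remaining terms cannot compensate (`bernoulliSum_injective`). So `bernoulliSum`
embeds the compact space of sign sequences in the line. Its image is the support of the law, and
atoms would come from atoms of coin tossing, of which there are none.

The absence of atoms drives the ergodic statements. Fubini and dominated convergence show that time
averages of a characteristic function recover the atom at `0` (`tendsto_mean_integral_cos`). Applied
to `μ ∗ μ`, whose characteristic function is `C²`, this is Wiener's lemma: `C²`, hence `|C|`, has
mean zero (`IsSpectralMeasure.isMeanNull`). Weak mixing then follows Maruyama's argument. Cosines of
finite linear combinations of coordinates span a dense subspace of `L²` of the path law
(`dense_span_pathTrigLp`). Their correlations under the shift are explicit and bounded by a multiple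
of a combination of translates of `C`. A bound uniform in time carries the conclusion to indicators
of events.

For the zeros, the spectral measure has bounded support, so `1 - C u ^ 2 ≤ K ^ 2 * u ^ 2`, and a
sign change between two times at distance `h` has probability at most `4 * K * h`. Almost surely a
zero in a short interval comes with values of both signs (`measure_iInf_eq_zero`), so the expected
number of grid cells containing a zero is bounded independently of the mesh, and infinitely many
zeros in a bounded interval have probability `0`. Finally, the zero configuration is a measurable
function of a continuous path that commutes with translation, so it inherits stationarity and weak
mixing. -/

lemma abs_coinSign (b : Bool) : |coinSign b| = 1 := by cases b <;> simp [coinSign]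

lemma abs_mul_coinSign (x : ℝ) (b : Bool) : |x * coinSign b| = |x| := by
  rw [abs_mul, abs_coinSign, mul_one]

lemma summable_mul_coinSign {lam : ℕ → ℝ} (hsum : Summable lam) (e : ℕ → Bool) :
    Summable fun k => lam k * coinSign (e k) :=
  Summable.of_norm_bounded hsum.abs fun _ => (abs_mul_coinSign _ _).le

lemma continuous_bernoulliSum {lam : ℕ → ℝ} (hsum : Summable lam) :
    Continuous (bernoulliSum lam) := by
  refine continuous_tsum (fun k => ?_) hsum.abs fun _ _ => (abs_mul_coinSign _ _).le
  exact continuous_const.mul ((continuous_of_discreteTopology (f := coinSign)).comp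
    (continuous_apply k))

lemma abs_bernoulliSum_le {lam : ℕ → ℝ} (hsum : Summable lam) (e : ℕ → Bool) :
    |bernoulliSum lam e| ≤ ∑' k, |lam k| := by
  have h := norm_tsum_le_tsum_norm (summable_mul_coinSign hsum e).norm
  simp_rw [Real.norm_eq_abs, abs_mul_coinSign] at h
  exact h

lemma measurable_bernoulliSum {lam : ℕ → ℝ} (hsum : Summable lam) :
    Measurable (bernoulliSum lam) :=
  (continuous_bernoulliSum hsum).measurable

instance isProbabilityMeasure_coinTossing : IsProbabilityMeasure coinTossing := by
  unfold coinTossing; infer_instance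

lemma isProbabilityMeasure_bernoulliConvolution {lam : ℕ → ℝ} (hsum : Summable lam) :
    IsProbabilityMeasure (bernoulliConvolution lam) :=
  Measure.isProbabilityMeasure_map (measurable_bernoulliSum hsum).aemeasurable

lemma integral_uniform_bool (f : Bool → ℂ) :
    ∫ b, f b ∂(PMF.uniformOfFintype Bool).toMeasure = (f true + f false) / 2 := by
  rw [PMF.integral_eq_sum]
  simp [PMF.uniformOfFintype_apply]
  ring

lemma integral_exp_partial_sum (lam : ℕ → ℝ) (t : ℝ) (n : ℕ) :
    ∫ e, Complex.exp (t * (∑ k ∈ Finset.range n, lam k * coinSign (e k) : ℝ) * Complex.I)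
      ∂coinTossing = ∏ k ∈ Finset.range n, (Real.cos (lam k * t) : ℂ) := by
  have hind : iIndepFun (fun (i : Fin n) (e : ℕ → Bool) => e i) coinTossing :=
    (iIndepFun_infinitePi (P := fun _ : ℕ => (PMF.uniformOfFintype Bool).toMeasure)
      (X := fun _ b => b) fun _ => measurable_id).precomp Fin.val_injective
  have h := iIndepFun.integral_fun_prod_comp (𝕜 := ℂ) (ι := Fin n) (μ := coinTossing)
    (X := fun i (e : ℕ → Bool) => e i)
    (f := fun i b => Complex.exp (t * (lam i * coinSign b : ℝ) * Complex.I))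
    hind (fun i => (measurable_pi_apply (i : ℕ)).aemeasurable) (fun i => (measurable_of_countable _).aestronglyMeasurable)
  rw [Finset.prod_range]
  have hval : ∀ i : Fin n, ∫ e : ℕ → Bool,
      Complex.exp (t * (lam i * coinSign (e i) : ℝ) * Complex.I) ∂coinTossing
        = (Real.cos (lam i * t) : ℂ) := by
    intro i
    have hmap := Measure.infinitePi_map_eval
      (fun _ : ℕ => (PMF.uniformOfFintype Bool).toMeasure) (i : ℕ)
    have := integral_map (μ := coinTossing) (φ := fun e : ℕ → Bool => e i)
      (f := fun b => Complex.exp (t * (lam i * coinSign b : ℝ) * Complex.I))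
      (measurable_pi_apply (i : ℕ)).aemeasurable (measurable_of_countable _).aestronglyMeasurable
    rw [← this]
    unfold coinTossing
    rw [hmap, integral_uniform_bool]
    simp only [coinSign]
    push_cast
    rw [Complex.cos]
    congr 1
    congr 1 <;> congr 1 <;> simp <;> ring
  rw [← Finset.prod_congr rfl fun i _ => hval i, ← h]
  refine integral_congr_ae (Eventually.of_forall fun e => ?_)
  simp only
  rw [← Complex.exp_sum, Finset.sum_range]
  push_cast
  rw [Finset.mul_sum, Finset.sum_mul]

lemma multipliable_cos {lam : ℕ → ℝ} (hsum : Summable lam) (t : ℝ) :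
    Multipliable fun k => Real.cos (lam k * t) := by
  have h : Summable fun k => Real.cos (lam k * t) - 1 := by
    refine Summable.of_norm_bounded (hsum.abs.mul_right |t|) fun k => ?_
    have := Real.abs_cos_sub_cos_le (lam k * t) 0
    simpa [abs_mul] using this
  simpa using Real.multipliable_one_add_of_summable h

lemma charFun_bernoulliConvolution {lam : ℕ → ℝ} (hsum : Summable lam) (t : ℝ) :
    charFun (bernoulliConvolution lam) t = (bernoulliCov lam t : ℂ) := by
  rw [charFun_apply_real, bernoulliConvolution,
    integral_map (measurable_bernoulliSum hsum).aemeasurable (by fun_prop)]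
  have h1 : Tendsto (fun n => ∫ e, Complex.exp
      (t * (∑ k ∈ Finset.range n, lam k * coinSign (e k) : ℝ) * Complex.I) ∂coinTossing) atTop
      (𝓝 (∫ e, Complex.exp (t * bernoulliSum lam e * Complex.I) ∂coinTossing)) := by
    refine tendsto_integral_of_dominated_convergence (fun _ => 1) (fun n => ?_)
      (integrable_const 1) (fun n => Eventually.of_forall fun e => ?_)
      (Eventually.of_forall fun e => ?_)
    · have hm : Measurable coinSign := measurable_of_countable _
      exact (Complex.measurable_exp.comp (((measurable_const.mul (Complex.measurable_ofReal.comp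
        (Finset.measurable_sum _ fun k _ =>
          (hm.comp (measurable_pi_apply k)).const_mul (lam k))))).mul_const _)).aestronglyMeasurable
    · rw [← Complex.ofReal_mul, Complex.norm_exp_ofReal_mul_I]
    · have h := (summable_mul_coinSign hsum e).hasSum.tendsto_sum_nat
      have hc : Continuous fun x : ℝ => Complex.exp (t * x * Complex.I) := by fun_prop
      exact (hc.tendsto _).comp h
  have h2 : Tendsto (fun n => ∏ k ∈ Finset.range n, (Real.cos (lam k * t) : ℂ)) atTop
      (𝓝 (bernoulliCov lam t : ℂ)) := by
    have h := (multipliable_cos hsum t).hasProd.tendsto_prod_nat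
    have h' := (Complex.continuous_ofReal.tendsto _).comp h
    refine h'.congr fun n => ?_
    simp
  simp_rw [integral_exp_partial_sum] at h1
  exact tendsto_nhds_unique h1 h2

/-! ### Injectivity and the support -/

lemma lam_pos {lam : ℕ → ℝ} (hlam : ∀ n, tailSum lam n < lam n ∧ 0 < tailSum lam n) (n : ℕ) :
    0 < lam n := (hlam n).2.trans (hlam n).1

/-- At the first index `n` where the signs differ, the two sums differ by `±2 * lam n`. The later
terms change this by at most `2 * tailSum lam n`, which is strictly smaller. -/
lemma bernoulliSum_injective {lam : ℕ → ℝ} (hsum : Summable lam)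
    (hlam : ∀ n, tailSum lam n < lam n ∧ 0 < tailSum lam n) :
    Function.Injective (bernoulliSum lam) := by
  classical
  intro e e' hee
  by_contra hne
  have hex : ∃ n, e n ≠ e' n := by
    by_contra h
    push Not at h
    exact hne (funext h)
  set n := Nat.find hex
  have hn : e n ≠ e' n := Nat.find_spec hex
  have hlt : ∀ k < n, e k = e' k := fun k hk => by simpa using Nat.find_min hex hk
  set d : ℕ → ℝ := fun k => lam k * coinSign (e k) - lam k * coinSign (e' k)
  have hd : Summable d := (summable_mul_coinSign hsum e).sub (summable_mul_coinSign hsum e')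
  have hd0 : ∑' k, d k = 0 := by
    rw [(summable_mul_coinSign hsum e).tsum_sub (summable_mul_coinSign hsum e')]
    exact sub_eq_zero.2 hee
  have hsplit := hd.sum_add_tsum_nat_add (n + 1)
  rw [hd0, Finset.sum_range_succ, Finset.sum_eq_zero, zero_add] at hsplit
  swap
  · intro k hk
    simp [d, hlt k (Finset.mem_range.1 hk)]
  have hdn : |d n| = 2 * lam n := by
    have := lam_pos hlam n
    have : d n = 2 * lam n ∨ d n = - (2 * lam n) := by
      simp only [d]
      rcases h1 : e n <;> rcases h2 : e' n <;> simp [h1, h2, coinSign] at hn ⊢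
      · right; ring
      · left; ring
    rcases this with h | h <;> rw [h] <;> simp <;> linarith
  have hs : Summable fun k => lam (n + 1 + k) := by
    simpa [add_comm] using (summable_nat_add_iff (n + 1)).2 hsum
  have htail : |∑' k, d (k + (n + 1))| ≤ 2 * tailSum lam n := by
    rw [tailSum, ← tsum_mul_left]
    refine tsum_of_norm_bounded (E := ℝ) (hs.mul_left 2).hasSum fun k => ?_
    have h1 := norm_sub_le (lam (k + (n + 1)) * coinSign (e (k + (n + 1))))
      (lam (k + (n + 1)) * coinSign (e' (k + (n + 1))))
    simp only [Real.norm_eq_abs, abs_mul_coinSign] at h1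
    rw [abs_of_pos (lam_pos hlam _)] at h1
    rw [Real.norm_eq_abs, show n + 1 + k = k + (n + 1) by ring]
    linarith
  have : d n = - ∑' k, d (k + (n + 1)) := by linarith
  rw [this, abs_neg] at hdn
  linarith [(hlam n).1]

lemma coinTossing_cylinder (I : Finset ℕ) (e : ℕ → Bool) :
    coinTossing ((I : Set ℕ).pi fun i => {e i}) = 2⁻¹ ^ I.card := by
  unfold coinTossing
  rw [Measure.infinitePi_pi _ fun i _ => measurableSet_singleton _]
  simp [PMF.uniformOfFintype_apply]

lemma coinTossing_singleton (e : ℕ → Bool) : coinTossing {e} = 0 := by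
  have h : ∀ n : ℕ, coinTossing {e} ≤ 2⁻¹ ^ n := fun n => by
    have := coinTossing_cylinder (Finset.range n) e
    rw [Finset.card_range] at this
    rw [← this]
    exact measure_mono (by rintro _ rfl; simp [Set.mem_pi])
  have ht : Tendsto (fun n : ℕ => (2⁻¹ : ENNReal) ^ n) atTop (𝓝 0) :=
    ENNReal.tendsto_pow_atTop_nhds_zero_of_lt_one (by simp)
  exact le_antisymm (ge_of_tendsto' ht h) bot_le

/-- An open set contains a cylinder around each of its points, and a cylinder fixing `m` coordinates
has mass `2⁻¹ ^ m`. -/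
lemma coinTossing_pos_of_isOpen {U : Set (ℕ → Bool)} (hU : IsOpen U) {e : ℕ → Bool}
    (he : e ∈ U) : 0 < coinTossing U := by
  obtain ⟨I, u, hu, hsub⟩ := isOpen_pi_iff.1 hU e he
  refine lt_of_lt_of_le ?_ (measure_mono (s := (I : Set ℕ).pi fun i => {e i})
    ((Set.pi_mono fun i hi => ?_).trans hsub))
  · rw [coinTossing_cylinder]
    exact ENNReal.pow_pos (by simp) _
  · rintro _ rfl
    exact (hu i hi).2

lemma bernoulliConvolution_singleton {lam : ℕ → ℝ} (hsum : Summable lam)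
    (hlam : ∀ n, tailSum lam n < lam n ∧ 0 < tailSum lam n) (x : ℝ) :
    bernoulliConvolution lam {x} = 0 := by
  rw [bernoulliConvolution, Measure.map_apply (measurable_bernoulliSum hsum)
    (measurableSet_singleton x)]
  have hs : (bernoulliSum lam ⁻¹' {x}).Subsingleton :=
    Set.subsingleton_singleton.preimage (bernoulliSum_injective hsum hlam)
  rcases hs.eq_empty_or_singleton with h | ⟨e, h⟩
  · simp [h]
  · rw [h, coinTossing_singleton]

lemma support_bernoulliConvolution {lam : ℕ → ℝ} (hsum : Summable lam) :
    (bernoulliConvolution lam).support = Set.range (bernoulliSum lam) := by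
  have hmeas := measurable_bernoulliSum hsum
  have hclosed : IsClosed (Set.range (bernoulliSum lam)) :=
    (isCompact_range (continuous_bernoulliSum hsum)).isClosed
  refine Set.Subset.antisymm (Measure.support_subset_of_isClosed hclosed ?_) ?_
  · rw [mem_ae_iff, bernoulliConvolution, Measure.map_apply hmeas hclosed.measurableSet.compl]
    simp
  · rintro _ ⟨e, rfl⟩
    rw [Measure.mem_support_iff_forall]
    intro U hU
    obtain ⟨V, hVU, hV, heV⟩ := mem_nhds_iff.1 hU
    refine lt_of_lt_of_le ?_ (measure_mono hVU)
    rw [bernoulliConvolution, Measure.map_apply hmeas hV.measurableSet]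
    exact coinTossing_pos_of_isOpen (hV.preimage (continuous_bernoulliSum hsum)) heV

/-- Near an isolated point of the support, all mass would sit on that point or off the support, and
both are null. -/
lemma preperfect_support_of_forall_singleton {μ : Measure ℝ} (h : ∀ x, μ {x} = 0) :
    Preperfect μ.support := by
  intro x hx
  rw [accPt_iff_frequently]
  intro hev
  rw [Measure.mem_support_iff_forall] at hx
  have hpos := hx _ hev
  refine hpos.ne' (measure_mono_null (t := {x} ∪ μ.supportᶜ) (fun y hy => ?_) ?_)
  · by_cases hyx : y = x
    · exact Or.inl hyx
    · exact Or.inr fun hys => hy ⟨hyx, hys⟩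
  · exact measure_union_null (h x) Measure.measure_compl_support

lemma isCantorType_support_bernoulliConvolution {lam : ℕ → ℝ} (hsum : Summable lam)
    (hlam : ∀ n, tailSum lam n < lam n ∧ 0 < tailSum lam n) :
    IsCantorType (bernoulliConvolution lam).support := by
  refine ⟨?_, ?_, preperfect_support_of_forall_singleton
    (bernoulliConvolution_singleton hsum hlam)⟩
  · rw [support_bernoulliConvolution hsum]
    exact isCompact_range (continuous_bernoulliSum hsum)
  · rw [support_bernoulliConvolution hsum]
    -- A continuous injection from a compact space to a Hausdorff one is an embedding, so the range
    -- inherits total disconnectedness from `ℕ → Bool`.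
    exact ((continuous_bernoulliSum hsum).isClosedEmbedding
      (bernoulliSum_injective hsum hlam)).isEmbedding.isTotallyDisconnected_range.2 inferInstance

/-! ### Time averages -/

/-- A continuous function whose absolute value has time averages tending to zero. -/
structure IsMeanNull (φ : ℝ → ℝ) : Prop where
  continuous : Continuous φ
  tendsto : Tendsto (fun T : ℝ => T⁻¹ * ∫ t in (0 : ℝ)..T, |φ t|) atTop (𝓝 0)

namespace IsMeanNull

lemma cesaroTendstoZero_abs {φ : ℝ → ℝ} (h : IsMeanNull φ) :
    CesaroTendstoZero fun t => |φ t| :=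
  ⟨fun _ => h.continuous.abs.intervalIntegrable _ _, h.tendsto⟩

lemma const_mul {φ : ℝ → ℝ} (h : IsMeanNull φ) (c : ℝ) : IsMeanNull fun t => c * φ t where
  continuous := h.continuous.const_mul c
  tendsto := by
    have := h.tendsto.const_mul |c|
    rw [mul_zero] at this
    refine this.congr fun T => ?_
    simp_rw [abs_mul]
    rw [intervalIntegral.integral_const_mul]
    ring

/-- The additive slack `ε` serves both the passage from `C²` to `|C|` and uniform approximation. -/
lemma of_le {ψ : ℝ → ℝ} (hψ : Continuous ψ)
    (h : ∀ ε > 0, ∃ φ, IsMeanNull φ ∧ ∀ t, |ψ t| ≤ ε + |φ t|) : IsMeanNull ψ where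
  continuous := hψ
  tendsto := by
    rw [Metric.tendsto_atTop]
    intro ε hε
    obtain ⟨φ, hφ, hle⟩ := h (ε / 2) (half_pos hε)
    obtain ⟨N, hN⟩ := (Metric.tendsto_atTop.1 hφ.tendsto) (ε / 2) (half_pos hε)
    refine ⟨max N 1, fun T hT => ?_⟩
    have hT1 : 1 ≤ T := (le_max_right _ _).trans hT
    have hT0 : 0 < T := by linarith
    have h1 := hN T ((le_max_left _ _).trans hT)
    have hint : ∫ t in (0 : ℝ)..T, |ψ t| ≤ ∫ t in (0 : ℝ)..T, (ε / 2 + |φ t|) :=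
      intervalIntegral.integral_mono_on hT0.le (hψ.abs.intervalIntegrable _ _)
        ((continuous_const.add hφ.continuous.abs).intervalIntegrable _ _) fun t _ => hle t
    rw [intervalIntegral.integral_add (continuous_const.intervalIntegrable _ _)
      (hφ.continuous.abs.intervalIntegrable _ _), intervalIntegral.integral_const, sub_zero,
      smul_eq_mul] at hint
    have hnn : 0 ≤ ∫ t in (0 : ℝ)..T, |ψ t| :=
      intervalIntegral.integral_nonneg hT0.le fun t _ => abs_nonneg _
    rw [Real.dist_0_eq_abs] at h1 ⊢
    rw [abs_of_nonneg (mul_nonneg (inv_nonneg.2 hT0.le) hnn)]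
    calc T⁻¹ * ∫ t in (0 : ℝ)..T, |ψ t|
        ≤ T⁻¹ * (T * (ε / 2) + ∫ t in (0 : ℝ)..T, |φ t|) := by gcongr
      _ = ε / 2 + T⁻¹ * ∫ t in (0 : ℝ)..T, |φ t| := by field_simp
      _ < ε := by linarith [le_abs_self (T⁻¹ * ∫ t in (0 : ℝ)..T, |φ t|)]

lemma of_le_mul {φ ψ : ℝ → ℝ} (hψ : Continuous ψ) (hφ : IsMeanNull φ) (K : ℝ)
    (h : ∀ t, |ψ t| ≤ K * |φ t|) : IsMeanNull ψ :=
  of_le hψ fun ε hε => ⟨_, hφ.const_mul K, fun t => by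
    rw [abs_mul]
    have := mul_le_mul_of_nonneg_right (le_abs_self K) (abs_nonneg (φ t))
    linarith [h t]⟩

lemma add {φ ψ : ℝ → ℝ} (hφ : IsMeanNull φ) (hψ : IsMeanNull ψ) :
    IsMeanNull fun t => φ t + ψ t := by
  have hsum : IsMeanNull fun t => |φ t| + |ψ t| := by
    refine ⟨hφ.continuous.abs.add hψ.continuous.abs, ?_⟩
    have := hφ.tendsto.add hψ.tendsto
    rw [add_zero] at this
    refine this.congr fun T => ?_
    rw [← mul_add, ← intervalIntegral.integral_add (hφ.continuous.abs.intervalIntegrable _ _)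
      (hψ.continuous.abs.intervalIntegrable _ _)]
    congr 2
    ext t
    exact (abs_of_nonneg (by positivity)).symm
  refine of_le_mul (hφ.continuous.add hψ.continuous) hsum 1 fun t => ?_
  rw [one_mul, abs_of_nonneg (by positivity : 0 ≤ |φ t| + |ψ t|)]
  exact abs_add_le _ _

lemma zero : IsMeanNull fun _ => 0 := ⟨continuous_const, by simp⟩

lemma sum {ι : Type*} (s : Finset ι) {φ : ι → ℝ → ℝ} (h : ∀ i ∈ s, IsMeanNull (φ i)) :
    IsMeanNull fun t => ∑ i ∈ s, φ i t := by
  classical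
  induction s using Finset.induction_on with
  | empty => simpa using zero
  | insert a s ha ih =>
    simp_rw [Finset.sum_insert ha]
    exact (h a (Finset.mem_insert_self _ _)).add
      (ih fun i hi => h i (Finset.mem_insert_of_mem hi))

/-- Continuity also passes to the uniform limit. This is what makes the correlation functions of
arbitrary measurable events integrable in time. -/
lemma of_uniform_approx {ψ : ℝ → ℝ}
    (h : ∀ ε > 0, ∃ φ, IsMeanNull φ ∧ ∀ t, |ψ t - φ t| ≤ ε) : IsMeanNull ψ := by
  have hcont : Continuous ψ := by
    refine continuous_of_uniform_approx_of_continuous fun u hu => ?_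
    obtain ⟨ε, hε, hsub⟩ := Metric.mem_uniformity_dist.1 hu
    obtain ⟨φ, hφ, hle⟩ := h (ε / 2) (half_pos hε)
    refine ⟨φ, hφ.continuous, fun t => hsub ?_⟩
    rw [Real.dist_eq]
    linarith [hle t]
  refine of_le hcont fun ε hε => ?_
  obtain ⟨φ, hφ, hle⟩ := h ε hε
  refine ⟨φ, hφ, fun t => ?_⟩
  have := abs_sub_abs_le_abs_sub (ψ t) (φ t)
  linarith [hle t]

end IsMeanNull

/-! ### Time averages of a characteristic function -/

lemma abs_integral_cos_le (s T x : ℝ) (hx : x ≠ 0) :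
    |∫ t in (0 : ℝ)..T, Real.cos ((s - t) * x)| ≤ 2 * |x|⁻¹ := by
  have h : ∀ t ∈ Set.uIcc (0 : ℝ) T,
      HasDerivAt (fun t => -(Real.sin ((s - t) * x) * x⁻¹)) (Real.cos ((s - t) * x)) t := by
    intro t _
    have h1 : HasDerivAt (fun t => (s - t) * x) (-1 * x) t :=
      ((hasDerivAt_id t).const_sub s).mul_const x
    convert! (h1.sin.mul_const x⁻¹).neg using 1
    field_simp
  rw [intervalIntegral.integral_eq_sub_of_hasDerivAt h
    ((by fun_prop : Continuous fun t => Real.cos ((s - t) * x)).intervalIntegrable _ _)]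
  have h1 := Real.abs_sin_le_one ((s - T) * x)
  have h2 := Real.abs_sin_le_one ((s - 0) * x)
  have : |-(Real.sin ((s - T) * x) * x⁻¹) - -(Real.sin ((s - 0) * x) * x⁻¹)|
      = |Real.sin ((s - 0) * x) - Real.sin ((s - T) * x)| * |x|⁻¹ := by
    rw [← abs_inv, ← abs_mul]; congr 1; ring
  rw [this]
  gcongr
  rw [abs_le] at *
  constructor <;> linarith

lemma continuous_integral_cos (ρ : Measure ℝ) [IsFiniteMeasure ρ] :
    Continuous fun u : ℝ => ∫ x, Real.cos (u * x) ∂ρ := by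
  refine continuous_of_dominated (bound := fun _ => 1) (fun u => by fun_prop)
    (fun u => Eventually.of_forall fun x => Real.abs_cos_le_one _) (integrable_const 1)
    (Eventually.of_forall fun x => by fun_prop)

/-- After exchanging the integrals, the time average of `cos ((s - t) * x)` is bounded by `1` and is
`O(1 / T)` for each `x ≠ 0`. Only an atom of `ρ` at `0` could contribute to the limit. -/
lemma tendsto_mean_integral_cos (ρ : Measure ℝ) [IsFiniteMeasure ρ] (h0 : ρ {0} = 0) (s : ℝ) :
    Tendsto (fun T : ℝ => T⁻¹ * ∫ t in (0 : ℝ)..T, ∫ x, Real.cos ((s - t) * x) ∂ρ) atTop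
      (𝓝 0) := by
  have hswap : ∀ T : ℝ, ∫ x, (T⁻¹ * ∫ t in (0 : ℝ)..T, Real.cos ((s - t) * x)) ∂ρ
      = T⁻¹ * ∫ t in (0 : ℝ)..T, ∫ x, Real.cos ((s - t) * x) ∂ρ := by
    intro T
    rw [integral_const_mul]
    congr 1
    have hfin : IsFiniteMeasure (volume.restrict (Set.uIoc (0 : ℝ) T)) := by
      unfold Set.uIoc; infer_instance
    have hint : Integrable (Function.uncurry fun t x : ℝ => Real.cos ((s - t) * x))
        ((volume.restrict (Set.uIoc (0 : ℝ) T)).prod ρ) :=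
      Integrable.of_bound (C := 1) (by fun_prop)
        (Eventually.of_forall fun p => Real.abs_cos_le_one _)
    exact (intervalIntegral_integral_swap hint).symm
  simp_rw [← hswap]
  suffices h : Tendsto (fun T : ℝ => ∫ x, (T⁻¹ * ∫ t in (0 : ℝ)..T, Real.cos ((s - t) * x)) ∂ρ)
      atTop (𝓝 (∫ _, (0 : ℝ) ∂ρ)) by rwa [integral_zero] at h
  refine tendsto_integral_filter_of_dominated_convergence (fun _ => 1) ?_ ?_
    (integrable_const 1) ?_
  · refine Eventually.of_forall fun T => Continuous.aestronglyMeasurable ?_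
    refine continuous_const.mul ?_
    exact intervalIntegral.continuous_parametric_intervalIntegral_of_continuous' (by fun_prop) _ _
  · filter_upwards [eventually_gt_atTop 0] with T hT
    refine Eventually.of_forall fun x => ?_
    have h := intervalIntegral.norm_integral_le_of_norm_le_const (a := 0) (b := T) (C := 1)
      (f := fun t => Real.cos ((s - t) * x)) fun t _ => Real.abs_cos_le_one _
    rw [sub_zero, one_mul, abs_of_pos hT] at h
    rw [norm_mul, norm_inv, Real.norm_of_nonneg hT.le]
    calc T⁻¹ * _ ≤ T⁻¹ * T := by gcongr
      _ = 1 := inv_mul_cancel₀ hT.ne'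
  · have hae : ∀ᵐ x ∂ρ, x ≠ 0 := by
      rw [ae_iff]; simpa using h0
    filter_upwards [hae] with x hx
    have hlim : Tendsto (fun T : ℝ => T⁻¹ * (2 * |x|⁻¹)) atTop (𝓝 0) := by
      simpa using tendsto_inv_atTop_zero.mul_const (2 * |x|⁻¹)
    refine squeeze_zero_norm' ?_ hlim
    filter_upwards [eventually_gt_atTop 0] with T hT
    rw [norm_mul, norm_inv, Real.norm_of_nonneg hT.le]
    gcongr
    exact abs_integral_cos_le s T x hx

/-- `C` is the characteristic function, assumed real, of the probability measure `μ`. -/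
structure IsSpectralMeasure (μ : Measure ℝ) (C : ℝ → ℝ) : Prop where
  isProbabilityMeasure : IsProbabilityMeasure μ
  charFun_eq : ∀ t, charFun μ t = (C t : ℂ)

namespace IsSpectralMeasure

variable {μ : Measure ℝ} {C : ℝ → ℝ}

lemma integral_cos_of_charFun_eq {ρ : Measure ℝ} [IsFiniteMeasure ρ] {t c : ℝ}
    (h : charFun ρ t = (c : ℂ)) : ∫ x, Real.cos (t * x) ∂ρ = c := by
  rw [charFun_apply_real] at h
  have hint : Integrable (fun x : ℝ => Complex.exp (t * x * Complex.I)) ρ := by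
    refine Integrable.of_bound (C := 1) (by fun_prop) (Eventually.of_forall fun x => ?_)
    rw [← Complex.ofReal_mul, Complex.norm_exp_ofReal_mul_I]
  have h1 := congrArg Complex.re h
  rw [Complex.ofReal_re, ← RCLike.re_eq_complex_re, ← integral_re hint] at h1
  rw [← h1]
  refine integral_congr_ae (Eventually.of_forall fun x => ?_)
  simp only [RCLike.re_eq_complex_re]
  rw [← Complex.ofReal_mul, Complex.exp_ofReal_mul_I_re]

lemma eq_integral_cos (h : IsSpectralMeasure μ C) (t : ℝ) :
    C t = ∫ x, Real.cos (t * x) ∂μ :=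
  have := h.isProbabilityMeasure
  (integral_cos_of_charFun_eq (h.charFun_eq t)).symm

lemma continuous (h : IsSpectralMeasure μ C) : Continuous C := by
  have := h.isProbabilityMeasure
  rw [funext h.eq_integral_cos]
  exact continuous_integral_cos μ

lemma zero (h : IsSpectralMeasure μ C) : C 0 = 1 := by
  have := h.isProbabilityMeasure
  simp [h.eq_integral_cos]

lemma neg (h : IsSpectralMeasure μ C) (t : ℝ) : C (-t) = C t := by
  simp [h.eq_integral_cos]

lemma abs_le_one (h : IsSpectralMeasure μ C) (t : ℝ) : |C t| ≤ 1 := by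
  have := h.isProbabilityMeasure
  rw [h.eq_integral_cos]
  simpa using norm_integral_le_of_norm_le_const (C := 1) (μ := μ)
    (f := fun x => Real.cos (t * x)) (Eventually.of_forall fun x => Real.abs_cos_le_one _)

lemma cesaroTendstoZero (h : IsSpectralMeasure μ C) (h0 : μ {0} = 0) : CesaroTendstoZero C := by
  have := h.isProbabilityMeasure
  refine ⟨fun T => h.continuous.intervalIntegrable _ _, ?_⟩
  refine (tendsto_mean_integral_cos μ h0 0).congr fun T => ?_
  congr 2
  ext t
  rw [← h.eq_integral_cos, zero_sub, h.neg]

/-- Wiener's lemma, through the convolution square `μ ∗ μ`, whose characteristic function is `C ^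
2`. -/
lemma isMeanNull (h : IsSpectralMeasure μ C) (hμ : ∀ x, μ {x} = 0) (s : ℝ) :
    IsMeanNull fun t => C (s - t) := by
  have := h.isProbabilityMeasure
  have hsq : ∀ t, ∫ x, Real.cos (t * x) ∂(μ ∗ μ) = C t ^ 2 := fun t =>
    integral_cos_of_charFun_eq (by rw [charFun_conv, h.charFun_eq]; push_cast; ring)
  -- The mass at `0` is the integral of `μ {-x}` against `μ`.
  have h0 : (μ ∗ μ) {0} = 0 := by
    rw [Measure.conv, Measure.map_apply (by fun_prop) (measurableSet_singleton _),
      Measure.measure_prod_null (measurable_add (measurableSet_singleton _))]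
    refine Eventually.of_forall fun x => ?_
    convert! hμ (-x) using 2
    ext y
    simp [eq_neg_iff_add_eq_zero, add_comm]
  have hcont : Continuous fun t => C (s - t) := h.continuous.comp (by fun_prop)
  have hnull : IsMeanNull fun t => C (s - t) ^ 2 := by
    refine ⟨hcont.pow 2, (tendsto_mean_integral_cos _ h0 s).congr fun T => ?_⟩
    simp_rw [hsq, abs_of_nonneg (sq_nonneg (C _))]
  -- From `(|c| - ε) ^ 2 ≥ 0` one gets `|c| ≤ ε + ε⁻¹ * c ^ 2`.
  refine IsMeanNull.of_le hcont fun ε hε => ⟨_, hnull.const_mul ε⁻¹, fun t => ?_⟩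
  rw [abs_of_nonneg (by positivity : 0 ≤ ε⁻¹ * C (s - t) ^ 2), inv_mul_eq_div, ← sub_le_iff_le_add', le_div_iff₀ hε,
    ← sq_abs]
  nlinarith [sq_nonneg (|C (s - t)| - ε), abs_nonneg (C (s - t))]

end IsSpectralMeasure

/-! ### Trigonometric functions on path space -/

/-- The trigonometric function `x ↦ cos (∑ s ∈ I, c s * x s + θ)` on path space, `p = (I, c, θ)`. -/
noncomputable def pathTrig (p : Finset ℝ × (ℝ → ℝ) × ℝ) (x : ℝ → ℝ) : ℝ :=
  Real.cos (∑ s ∈ p.1, p.2.1 s * x s + p.2.2)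

lemma measurable_pathTrig (p : Finset ℝ × (ℝ → ℝ) × ℝ) : Measurable (pathTrig p) :=
  Real.measurable_cos.comp ((Finset.measurable_sum _ fun s _ =>
    (measurable_pi_apply s).const_mul _).add_const _)

lemma abs_pathTrig_le_one (p : Finset ℝ × (ℝ → ℝ) × ℝ) (x : ℝ → ℝ) : |pathTrig p x| ≤ 1 :=
  Real.abs_cos_le_one _

lemma memLp_pathTrig (ν : Measure (ℝ → ℝ)) [IsFiniteMeasure ν]
    (p : Finset ℝ × (ℝ → ℝ) × ℝ) : MemLp (pathTrig p) 2 ν :=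
  MemLp.of_bound (measurable_pathTrig p).aestronglyMeasurable 1
    (Eventually.of_forall (abs_pathTrig_le_one p))

/-- The phases `0` and `-π / 2` give the real and imaginary parts of the characteristic functions of
all finite-dimensional marginals, which determine the law. -/
lemma ext_of_integral_pathTrig {ν₁ ν₂ : Measure (ℝ → ℝ)} [IsFiniteMeasure ν₁]
    [IsFiniteMeasure ν₂] (h : ∀ p, ∫ x, pathTrig p x ∂ν₁ = ∫ x, pathTrig p x ∂ν₂) : ν₁ = ν₂ := by
  refine IsProjectiveLimit.unique (P := fun I => ν₁.map I.restrict) (fun I => rfl) fun I => ?_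
  refine Measure.ext_of_charFunDual (funext fun L => ?_)
  -- The coordinates of the functional `L`, extended by zero off `I`.
  set c : ℝ → ℝ := fun s => if hs : s ∈ I then L (Pi.single ⟨s, hs⟩ 1) else 0
  have hL : ∀ x : ℝ → ℝ, L (I.restrict x) = ∑ s ∈ I, c s * x s := by
    intro x
    rw [← Finset.sum_coe_sort]
    conv_lhs => rw [← Finset.univ_sum_single (I.restrict x)]
    rw [map_sum]
    refine Finset.sum_congr rfl fun i _ => ?_
    have : Pi.single i (I.restrict x i) = x i • (Pi.single i 1 : I → ℝ) := by
      rw [← Pi.single_smul]; simp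
    rw [this, map_smul, smul_eq_mul, mul_comm]
    simp [c]
  have key : ∀ ν : Measure (ℝ → ℝ), IsFiniteMeasure ν → charFunDual (ν.map I.restrict) L
      = (∫ x, pathTrig (I, c, 0) x ∂ν : ℝ)
        + (∫ x, pathTrig (I, c, -(Real.pi / 2)) x ∂ν : ℝ) * Complex.I := by
    intro ν hν
    rw [charFunDual_apply, integral_map (by fun_prop) (by fun_prop)]
    rw [← integral_complex_ofReal, ← integral_complex_ofReal, ← integral_mul_const,
      ← integral_add]
    · refine integral_congr_ae (Eventually.of_forall fun x => ?_)
      simp only [pathTrig, hL, add_zero]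
      rw [← sub_eq_add_neg, Real.cos_sub_pi_div_two, Complex.exp_mul_I, Complex.ofReal_cos,
        Complex.ofReal_sin]
    · exact (((memLp_pathTrig ν _).integrable (by norm_num)).ofReal)
    · exact (((memLp_pathTrig ν _).integrable (by norm_num)).ofReal).mul_const _
  rw [key _ inferInstance, key _ inferInstance, h, h]

/-- The class of `pathTrig p` in `L²`. -/
noncomputable def pathTrigLp (ν : Measure (ℝ → ℝ)) [IsFiniteMeasure ν]
    (p : Finset ℝ × (ℝ → ℝ) × ℝ) : Lp ℝ 2 ν :=
  (memLp_pathTrig ν p).toLp (pathTrig p)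

lemma integral_withDensity_ofReal {ν : Measure (ℝ → ℝ)} {f : (ℝ → ℝ) → ℝ}
    (hf : AEMeasurable f ν) (g : (ℝ → ℝ) → ℝ) :
    ∫ x, g x ∂ν.withDensity (fun x => ENNReal.ofReal (f x)) = ∫ x, max (f x) 0 * g x ∂ν := by
  rw [integral_withDensity_eq_integral_toReal_smul₀ hf.ennreal_ofReal (by simp)]
  simp [ENNReal.toReal_ofReal']

/-- If `f` is orthogonal to every trigonometric function, the finite measures with densities `f⁺`
and `f⁻` have the same trigonometric integrals, hence coincide. Then `f⁺ = f⁻` almost everywhere,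
which forces `f = 0`. -/
lemma dense_span_pathTrigLp (ν : Measure (ℝ → ℝ)) [IsFiniteMeasure ν] :
    (Submodule.span ℝ (Set.range (pathTrigLp ν))).topologicalClosure = ⊤ := by
  rw [Submodule.topologicalClosure_eq_top_iff, Submodule.eq_bot_iff]
  intro f hf
  have hort : ∀ p, ∫ x, f x * pathTrig p x ∂ν = 0 := by
    intro p
    have h := (Submodule.mem_orthogonal _ _).1 hf _ (Submodule.subset_span ⟨p, rfl⟩)
    rw [L2.inner_def] at h
    rw [← h]
    refine integral_congr_ae ?_
    filter_upwards [(memLp_pathTrig ν p).coeFn_toLp] with x hx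
    rw [pathTrigLp, hx]
    simp
  have hfm : AEMeasurable f ν := (Lp.aestronglyMeasurable f).aemeasurable
  have hfm' : AEMeasurable (fun x => -f x) ν := hfm.neg
  have hfi : Integrable f ν := (Lp.memLp f).integrable (by norm_num)
  have hfi' : Integrable (fun x => -f x) ν := hfi.neg
  have hmul : ∀ {g : (ℝ → ℝ) → ℝ}, Integrable g ν → ∀ p,
      Integrable (fun x => g x * pathTrig p x) ν := fun hg p =>
    hg.mul_bdd (c := 1) (measurable_pathTrig p).aestronglyMeasurable
      (Eventually.of_forall (abs_pathTrig_le_one p))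
  have : IsFiniteMeasure (ν.withDensity fun x => ENNReal.ofReal (f x)) :=
    isFiniteMeasure_withDensity_ofReal hfi.2
  have : IsFiniteMeasure (ν.withDensity fun x => ENNReal.ofReal (-f x)) :=
    isFiniteMeasure_withDensity_ofReal hfi.neg.2
  have heq : ν.withDensity (fun x => ENNReal.ofReal (f x))
      = ν.withDensity fun x => ENNReal.ofReal (-f x) := by
    refine ext_of_integral_pathTrig fun p => ?_
    rw [integral_withDensity_ofReal hfm, integral_withDensity_ofReal hfm', ← sub_eq_zero,
      ← integral_sub (hmul hfi.pos_part p) (hmul hfi'.pos_part p)]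
    refine Eq.trans ?_ (hort p)
    refine integral_congr_ae (Eventually.of_forall fun x => ?_)
    simp only
    rw [← sub_mul]
    rw [max_zero_sub_max_neg_zero_eq_self]
  rw [withDensity_eq_iff_of_sigmaFinite hfm.ennreal_ofReal hfm'.ennreal_ofReal] at heq
  rw [Lp.eq_zero_iff_ae_eq_zero]
  filter_upwards [heq] with x hx
  have h1 := congrArg ENNReal.toReal hx
  simp only [ENNReal.toReal_ofReal'] at h1
  rcases le_total (f x) 0 with h | h <;> simp [h] at h1 ⊢ <;> linarith

/-! ### Linear combinations of a stationary Gaussian process -/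

/-- The path law of a process. -/
noncomputable def pathLaw {Ω : Type*} [MeasurableSpace Ω] (X : ℝ → Ω → ℝ) (P : Measure Ω) :
    Measure (ℝ → ℝ) := P.map fun ω s => X s ω

/-- The shift on path space. -/
def pathShift (t : ℝ) (x : ℝ → ℝ) : ℝ → ℝ := fun s => x (s + t)

lemma measurable_pathShift (t : ℝ) : Measurable (pathShift t) :=
  measurable_pi_lambda _ fun _ => measurable_pi_apply _

lemma integral_cos_add_const_of_hasGaussianLaw {Ω : Type*} [MeasurableSpace Ω] {P : Measure Ω}
    {U : Ω → ℝ} (hU : HasGaussianLaw U P) (h0 : ∫ ω, U ω ∂P = 0) (θ : ℝ) :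
    ∫ ω, Real.cos (U ω + θ) ∂P = Real.exp (-Var[U; P] / 2) * Real.cos θ := by
  have := hU.isProbabilityMeasure
  have h1 : ∫ ω, Complex.exp (U ω * Complex.I) ∂P = Real.exp (-Var[U; P] / 2) := by
    have h := charFun_gaussianReal (μ := 0) (v := Var[U; P].toNNReal) 1
    rw [← h0, ← hU.map_eq_gaussianReal, charFun_apply_real,
      integral_map hU.aemeasurable (by fun_prop), h0] at h
    simp only [Complex.ofReal_one, one_mul] at h
    rw [h]
    push_cast
    rw [Real.coe_toNNReal _ (variance_nonneg _ _)]
    congr 1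
    simp
    ring
  have hint : Integrable (fun ω => Complex.exp (U ω * Complex.I)) P := by
    refine Integrable.of_bound (C := 1) ?_ (Eventually.of_forall fun ω => ?_)
    · have := hU.aemeasurable
      exact (by fun_prop : AEMeasurable (fun ω => Complex.exp (U ω * Complex.I)) P).aestronglyMeasurable
    · rw [Complex.norm_exp_ofReal_mul_I]
  -- Multiplying the characteristic function at `1` by `exp (iθ)` and taking real parts brings in
  -- the phase.
  have h2 := congrArg (fun z => (z * Complex.exp (θ * Complex.I)).re) h1
  rw [← integral_mul_const, ← RCLike.re_eq_complex_re, ← integral_re (hint.mul_const _)] at h2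
  rw [RCLike.re_eq_complex_re, Complex.re_ofReal_mul, Complex.exp_ofReal_mul_I_re] at h2
  rw [← h2]
  refine integral_congr_ae (Eventually.of_forall fun ω => ?_)
  beta_reduce
  rw [← Complex.exp_add, ← add_mul, ← Complex.ofReal_add, Complex.exp_ofReal_mul_I_re]

namespace IsStationaryGaussian

variable {Ω : Type*} [MeasurableSpace Ω] {P : Measure Ω} {X : ℝ → Ω → ℝ} {C : ℝ → ℝ}

lemma measurable_path (h : IsStationaryGaussian X P C) : Measurable fun ω s => X s ω :=
  measurable_pi_lambda _ h.measurable

lemma memLp_two (h : IsStationaryGaussian X P C) (s : ℝ) : MemLp (X s) 2 P :=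
  (h.gaussian.hasGaussianLaw_eval s).memLp_two

lemma hasGaussianLaw_linComb (h : IsStationaryGaussian X P C) {ι : Type*} [Fintype ι]
    (c s : ι → ℝ) : HasGaussianLaw (fun ω => ∑ i, c i * X (s i) ω) P := by
  have h1 : IsGaussianProcess (fun i ω => c i * X (s i) ω) P := (h.gaussian.comp_right s).smul c
  exact h1.hasGaussianLaw_fun_sum

lemma integral_linComb (h : IsStationaryGaussian X P C) {ι : Type*} [Fintype ι]
    (c s : ι → ℝ) : ∫ ω, ∑ i, c i * X (s i) ω ∂P = 0 := by
  have := h.gaussian.isProbabilityMeasure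
  rw [integral_finsetSum _ fun i _ => ((h.memLp_two _).integrable (by norm_num)).const_mul _]
  simp [integral_const_mul, h.centred]

lemma variance_linComb (h : IsStationaryGaussian X P C) {ι : Type*} [Fintype ι]
    (c s : ι → ℝ) :
    Var[fun ω => ∑ i, c i * X (s i) ω; P] = ∑ i, ∑ j, c i * c j * C (s i - s j) := by
  have := h.gaussian.isProbabilityMeasure
  have hm : ∀ i, MemLp (fun ω => c i * X (s i) ω) 2 P := fun i => (h.memLp_two _).const_mul _
  rw [← covariance_self (h.hasGaussianLaw_linComb c s).aemeasurable,
    covariance_fun_sum_fun_sum hm hm]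
  simp_rw [covariance_const_mul_left, covariance_const_mul_right, h.covariance_eq, mul_assoc]

lemma integral_cos_linComb (h : IsStationaryGaussian X P C) {ι : Type*} [Fintype ι]
    (c s : ι → ℝ) (θ : ℝ) :
    ∫ ω, Real.cos (∑ i, c i * X (s i) ω + θ) ∂P
      = Real.exp (-(∑ i, ∑ j, c i * c j * C (s i - s j)) / 2) * Real.cos θ := by
  rw [integral_cos_add_const_of_hasGaussianLaw (h.hasGaussianLaw_linComb c s)
    (h.integral_linComb c s), h.variance_linComb]

/-- The integral of a trigonometric function depends on its times only through their differences. -/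
lemma measurePreserving_pathShift (h : IsStationaryGaussian X P C) (t : ℝ) :
    MeasurePreserving (pathShift t) (pathLaw X P) (pathLaw X P) := by
  refine ⟨measurable_pathShift t, ?_⟩
  have := h.gaussian.isProbabilityMeasure
  rw [pathLaw, Measure.map_map (measurable_pathShift t) h.measurable_path]
  have hm : Measurable (pathShift t ∘ fun ω s => X s ω) :=
    (measurable_pathShift t).comp h.measurable_path
  refine ext_of_integral_pathTrig fun p => ?_
  rw [integral_map hm.aemeasurable (measurable_pathTrig p).aestronglyMeasurable,
    integral_map h.measurable_path.aemeasurable (measurable_pathTrig p).aestronglyMeasurable]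
  simp only [pathTrig, Function.comp_apply, pathShift]
  simp_rw [← Finset.sum_coe_sort p.1]
  rw [h.integral_cos_linComb (fun i : p.1 => p.2.1 i) (fun i : p.1 => (i : ℝ) + t),
    h.integral_cos_linComb (fun i : p.1 => p.2.1 i) (fun i : p.1 => (i : ℝ))]
  simp

end IsStationaryGaussian

/-! ### Weak mixing of stationary Gaussian processes -/

lemma abs_exp_sub_one_le_mul_exp (x : ℝ) : |Real.exp x - 1| ≤ |x| * Real.exp |x| := by
  rcases le_total 0 x with hx | hx
  · have h1 : 1 ≤ Real.exp x := Real.one_le_exp hx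
    have h2 := Real.add_one_le_exp (-x)
    rw [abs_of_nonneg (by linarith), abs_of_nonneg hx]
    have h3 : Real.exp x * Real.exp (-x) = 1 := by rw [← Real.exp_add]; simp
    nlinarith [Real.exp_pos x]
  · have h1 : Real.exp x ≤ 1 := Real.exp_le_one_iff.2 hx
    have h2 := Real.add_one_le_exp x
    have h3 : 1 ≤ Real.exp |x| := Real.one_le_exp (abs_nonneg x)
    rw [abs_of_nonpos (by linarith)]
    nlinarith [abs_nonneg x, neg_le_abs x]

section

variable {Ω : Type*} [MeasurableSpace Ω] {P : Measure Ω}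

/-- The covariance of `cos (U + θ)` and `cos (V + φ)` for jointly Gaussian `U`, `V` with variances
summing to `v` and covariance `c`. -/
noncomputable def cosCov (v θ φ c : ℝ) : ℝ :=
  1 / 2 * Real.exp (-v / 2) *
    ((Real.exp (-c) - 1) * Real.cos (θ + φ) + (Real.exp c - 1) * Real.cos (θ - φ))

lemma continuous_cosCov (v θ φ : ℝ) : Continuous (cosCov v θ φ) := by
  unfold cosCov; fun_prop

lemma abs_cosCov_le {v : ℝ} (hv : 0 ≤ v) (θ φ c : ℝ) :
    |cosCov v θ φ c| ≤ |c| * Real.exp |c| := by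
  have h1 := abs_exp_sub_one_le_mul_exp c
  have h2 := abs_exp_sub_one_le_mul_exp (-c)
  rw [abs_neg] at h2
  have h3 : Real.exp (-v / 2) ≤ 1 := Real.exp_le_one_iff.2 (by linarith)
  have h4 : |(Real.exp (-c) - 1) * Real.cos (θ + φ) + (Real.exp c - 1) * Real.cos (θ - φ)|
      ≤ 2 * (|c| * Real.exp |c|) := by
    refine (abs_add_le _ _).trans ?_
    rw [abs_mul, abs_mul]
    have h5 := mul_le_mul h2 (Real.abs_cos_le_one (θ + φ)) (abs_nonneg _) (by positivity)
    have h6 := mul_le_mul h1 (Real.abs_cos_le_one (θ - φ)) (abs_nonneg _) (by positivity)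
    linarith
  rw [cosCov, abs_mul, abs_of_nonneg (by positivity : 0 ≤ 1 / 2 * Real.exp (-v / 2))]
  calc 1 / 2 * Real.exp (-v / 2) * _ ≤ 1 / 2 * 1 * (2 * (|c| * Real.exp |c|)) := by gcongr
    _ = _ := by ring

/-- The product formula for cosines reduces everything to `U + V` and `U - V`, whose variances are
`Var U + Var V ± 2 cov(U, V)`. -/
lemma integral_cos_mul_cos_sub {U V : Ω → ℝ} (hU : HasGaussianLaw U P) (hV : HasGaussianLaw V P)
    (hadd : HasGaussianLaw (U + V) P) (hsub : HasGaussianLaw (U - V) P)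
    (hU0 : ∫ ω, U ω ∂P = 0) (hV0 : ∫ ω, V ω ∂P = 0) (θ φ : ℝ) :
    ∫ ω, Real.cos (U ω + θ) * Real.cos (V ω + φ) ∂P
      - (∫ ω, Real.cos (U ω + θ) ∂P) * ∫ ω, Real.cos (V ω + φ) ∂P
      = cosCov (Var[U; P] + Var[V; P]) θ φ cov[U, V; P] := by
  have := hU.isProbabilityMeasure
  have hUi := hU.memLp_two.integrable (by norm_num)
  have hVi := hV.memLp_two.integrable (by norm_num)
  have hint : ∀ {W : Ω → ℝ}, AEMeasurable W P → ∀ a,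
      Integrable (fun ω => Real.cos (W ω + a)) P := fun hW a =>
    Integrable.of_bound (C := 1)
      (Real.measurable_cos.comp_aemeasurable (hW.add_const a)).aestronglyMeasurable
      (Eventually.of_forall fun ω => Real.abs_cos_le_one _)
  have hprod : ∀ ω, Real.cos (U ω + θ) * Real.cos (V ω + φ)
      = 1 / 2 * (Real.cos ((U + V) ω + (θ + φ)) + Real.cos ((U - V) ω + (θ - φ))) := by
    intro ω
    simp only [Pi.add_apply, Pi.sub_apply]
    rw [show U ω + V ω + (θ + φ) = (U ω + θ) + (V ω + φ) by ring,
      show U ω - V ω + (θ - φ) = (U ω + θ) - (V ω + φ) by ring, Real.cos_add (U ω + θ),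
      Real.cos_sub (U ω + θ)]
    ring
  simp_rw [hprod]
  rw [integral_const_mul, integral_add (hint hadd.aemeasurable _) (hint hsub.aemeasurable _),
    integral_cos_add_const_of_hasGaussianLaw hU hU0,
    integral_cos_add_const_of_hasGaussianLaw hV hV0,
    integral_cos_add_const_of_hasGaussianLaw hadd
      (by simp [integral_add hUi hVi, hU0, hV0]),
    integral_cos_add_const_of_hasGaussianLaw hsub
      (by simp [integral_sub hUi hVi, hU0, hV0]),
    variance_add hU.memLp_two hV.memLp_two, variance_sub hU.memLp_two hV.memLp_two, cosCov]
  set u := Var[U; P]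
  set v := Var[V; P]
  set c := cov[U, V; P]
  rw [show -(u + 2 * c + v) / 2 = -u / 2 + -v / 2 + -c by ring,
    show -(u - 2 * c + v) / 2 = -u / 2 + -v / 2 + c by ring,
    show -(u + v) / 2 = -u / 2 + -v / 2 by ring, Real.exp_add _ (-c), Real.exp_add _ c,
    Real.exp_add, Real.cos_add, Real.cos_sub]
  ring

lemma isMeanNull_of_dense_span {E : Type*} [NormedAddCommGroup E] [NormedSpace ℝ E] {S : Set E}
    (hS : (Submodule.span ℝ S).topologicalClosure = ⊤) {F : E → ℝ → ℝ}
    (hadd : ∀ f g t, F (f + g) t = F f t + F g t) (hsmul : ∀ (c : ℝ) f t, F (c • f) t = c * F f t)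
    {K : ℝ} (hK : ∀ f t, |F f t| ≤ K * ‖f‖) (h : ∀ f ∈ S, IsMeanNull (F f)) (f : E) :
    IsMeanNull (F f) := by
  have hspan : ∀ g ∈ Submodule.span ℝ S, IsMeanNull (F g) := by
    intro g hg
    induction hg using Submodule.span_induction with
    | mem x hx => exact h x hx
    | zero =>
      have : F 0 = fun _ => 0 := funext fun t => by simpa using hsmul 0 0 t
      rw [this]
      exact IsMeanNull.zero
    | add x y _ _ hx hy => exact (funext (hadd x y)).symm ▸ hx.add hy
    | smul c x _ hx => exact (funext (hsmul c x)).symm ▸ hx.const_mul c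
  refine IsMeanNull.of_uniform_approx fun ε hε => ?_
  have hf : f ∈ closure (Submodule.span ℝ S : Set E) := by
    rw [← Submodule.topologicalClosure_coe, hS]
    trivial
  -- Using `|K| + 1` keeps the denominator positive whatever the sign of `K`.
  obtain ⟨g, hg, hfg⟩ := Metric.mem_closure_iff.1 hf (ε / (|K| + 1)) (by positivity)
  refine ⟨F g, hspan g hg, fun t => ?_⟩
  have hsub : F f t - F g t = F (f - g) t := by
    have := hadd (f - g) g t
    rw [sub_add_cancel] at this
    linarith
  rw [hsub]
  rw [dist_eq_norm, lt_div_iff₀ (by positivity)] at hfg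
  have := mul_le_mul_of_nonneg_right (le_abs_self K) (norm_nonneg (f - g))
  have h1 := hK (f - g) t
  nlinarith [norm_nonneg (f - g)]

end

/-- The form `⟨f, g ∘ θ_t⟩ - ⟨f, 1⟩ ⟨1, g⟩` on the `L²` space of a shift-invariant law. -/
noncomputable def mixingForm {ν : Measure (ℝ → ℝ)} [IsFiniteMeasure ν]
    (hν : ∀ t, MeasurePreserving (pathShift t) ν ν) (f g : Lp ℝ 2 ν) (t : ℝ) : ℝ :=
  inner ℝ f (Lp.compMeasurePreservingₗᵢ ℝ (pathShift t) (hν t) g)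
    - inner ℝ f (indicatorConstLp 2 MeasurableSet.univ (measure_ne_top ν _) (1 : ℝ))
      * inner ℝ (indicatorConstLp 2 MeasurableSet.univ (measure_ne_top ν _) (1 : ℝ)) g

section

variable {ν : Measure (ℝ → ℝ)} [IsProbabilityMeasure ν]
  (hν : ∀ t, MeasurePreserving (pathShift t) ν ν)

/-- Cauchy–Schwarz, with the shift an isometry and the constant `1` of norm one. The bound does not
depend on `t`, so density arguments are uniform in time. -/
lemma abs_mixingForm_le (f g : Lp ℝ 2 ν) (t : ℝ) : |mixingForm hν f g t| ≤ 2 * ‖f‖ * ‖g‖ := by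
  set e : Lp ℝ 2 ν := indicatorConstLp 2 MeasurableSet.univ (measure_ne_top ν _) (1 : ℝ) with he
  have hone : ‖e‖ = 1 := by
    rw [he, norm_indicatorConstLp (by norm_num) (by norm_num)]; simp
  have h1 := abs_real_inner_le_norm f (Lp.compMeasurePreservingₗᵢ ℝ (pathShift t) (hν t) g)
  rw [LinearIsometry.norm_map] at h1
  have h2 := abs_real_inner_le_norm f e
  have h3 := abs_real_inner_le_norm e g
  rw [hone] at h2 h3
  refine (abs_sub_le _ 0 _).trans ?_
  rw [sub_zero, zero_sub, abs_neg, abs_mul]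
  have := mul_le_mul h2 h3 (abs_nonneg _) (by positivity)
  linarith

lemma isMeanNull_mixingForm (h : ∀ p q, IsMeanNull (mixingForm hν (pathTrigLp ν p) (pathTrigLp ν q)))
    (f g : Lp ℝ 2 ν) : IsMeanNull (mixingForm hν f g) := by
  have h1 : ∀ q f, IsMeanNull (mixingForm hν f (pathTrigLp ν q)) := fun q =>
    isMeanNull_of_dense_span (dense_span_pathTrigLp ν)
      (F := fun f => mixingForm hν f (pathTrigLp ν q))
      (K := 2 * ‖pathTrigLp ν q‖)
      (fun f g t => by simp only [mixingForm, inner_add_left]; ring)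
      (fun c f t => by simp only [mixingForm, real_inner_smul_left]; ring)
      (fun f t => (abs_mixingForm_le hν _ _ t).trans_eq (by ring))
      (by rintro _ ⟨p, rfl⟩; exact h p q)
  exact isMeanNull_of_dense_span (dense_span_pathTrigLp ν) (F := fun g => mixingForm hν f g)
    (K := 2 * ‖f‖)
    (fun f g t => by simp only [mixingForm, inner_add_right, map_add]; ring)
    (fun c f t => by simp only [mixingForm, real_inner_smul_right, map_smul]; ring)
    (fun g t => abs_mixingForm_le hν _ _ t)
    (by rintro _ ⟨q, rfl⟩; exact h1 q f) g

lemma mixingForm_indicator {A B : Set (ℝ → ℝ)} (hA : MeasurableSet A) (hB : MeasurableSet B)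
    (t : ℝ) :
    mixingForm hν (indicatorConstLp 2 hA (measure_ne_top ν _) (1 : ℝ))
      (indicatorConstLp 2 hB (measure_ne_top ν _) (1 : ℝ)) t
      = ν.real (A ∩ pathShift t ⁻¹' B) - ν.real A * ν.real B := by
  rw [mixingForm]
  have : Lp.compMeasurePreservingₗᵢ ℝ (pathShift t) (hν t)
      (indicatorConstLp 2 hB (measure_ne_top ν _) (1 : ℝ))
      = indicatorConstLp 2 (hB.preimage (hν t).measurable) (measure_ne_top ν _) (1 : ℝ) := rfl
  rw [this, L2.real_inner_indicatorConstLp_one_indicatorConstLp_one,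
    L2.real_inner_indicatorConstLp_one_indicatorConstLp_one,
    L2.real_inner_indicatorConstLp_one_indicatorConstLp_one]
  simp

lemma mixingForm_pathTrigLp (p q : Finset ℝ × (ℝ → ℝ) × ℝ) (t : ℝ) :
    mixingForm hν (pathTrigLp ν p) (pathTrigLp ν q) t
      = ∫ x, pathTrig p x * pathTrig q (pathShift t x) ∂ν
        - (∫ x, pathTrig p x ∂ν) * ∫ x, pathTrig q (pathShift t x) ∂ν := by
  have h1 : ∀ p, inner ℝ (indicatorConstLp 2 MeasurableSet.univ (measure_ne_top ν _) (1 : ℝ))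
      (pathTrigLp ν p) = ∫ x, pathTrig p x ∂ν := by
    intro p
    rw [L2.inner_indicatorConstLp_one, setIntegral_univ]
    exact integral_congr_ae (memLp_pathTrig ν p).coeFn_toLp
  have h2 : ∫ x, pathTrig q (pathShift t x) ∂ν = ∫ x, pathTrig q x ∂ν := by
    conv_rhs => rw [← (hν t).map_eq]
    rw [integral_map (hν t).measurable.aemeasurable (measurable_pathTrig q).aestronglyMeasurable]
  rw [mixingForm, h1, real_inner_comm _ (pathTrigLp ν p), real_inner_comm _ (pathTrigLp ν p), h1,
    h2, real_inner_comm, L2.inner_def]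
  congr 1
  refine integral_congr_ae ?_
  have h3 := Lp.coeFn_compMeasurePreserving (pathTrigLp ν q) (hν t)
  have h4 := (hν t).quasiMeasurePreserving.ae_eq_comp (memLp_pathTrig ν q).coeFn_toLp
  filter_upwards [(memLp_pathTrig ν p).coeFn_toLp, h3, h4] with x hp hq hq'
  have : (Lp.compMeasurePreservingₗᵢ ℝ (pathShift t) (hν t) (pathTrigLp ν q)) x
      = pathTrig q (pathShift t x) := hq.trans hq'
  rw [this, pathTrigLp, hp]
  simp [mul_comm]

end

namespace IsStationaryGaussian

variable {Ω : Type*} [MeasurableSpace Ω] {P : Measure Ω} {X : ℝ → Ω → ℝ} {C : ℝ → ℝ}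

lemma isProbabilityMeasure_pathLaw (h : IsStationaryGaussian X P C) :
    IsProbabilityMeasure (pathLaw X P) :=
  have := h.gaussian.isProbabilityMeasure
  Measure.isProbabilityMeasure_map h.measurable_path.aemeasurable

lemma integral_pathTrig_mul_sub (h : IsStationaryGaussian X P C)
    (p q : Finset ℝ × (ℝ → ℝ) × ℝ) (t : ℝ) :
    ∫ x, pathTrig p x * pathTrig q (pathShift t x) ∂pathLaw X P
        - (∫ x, pathTrig p x ∂pathLaw X P) * ∫ x, pathTrig q (pathShift t x) ∂pathLaw X P
      = cosCov ((∑ i : p.1, ∑ j : p.1, p.2.1 i * p.2.1 j * C (i - j))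
          + ∑ i : q.1, ∑ j : q.1, q.2.1 i * q.2.1 j * C (i - j)) p.2.2 q.2.2
        (∑ i : p.1, ∑ j : q.1, p.2.1 i * q.2.1 j * C ((i : ℝ) - j - t)) := by
  have hm := measurable_pathTrig
  have hq : Measurable fun x => pathTrig q (pathShift t x) := (hm q).comp (measurable_pathShift t)
  have hpq : Measurable fun x => pathTrig p x * pathTrig q (pathShift t x) := (hm p).mul hq
  rw [pathLaw, integral_map h.measurable_path.aemeasurable hpq.aestronglyMeasurable,
    integral_map h.measurable_path.aemeasurable (hm p).aestronglyMeasurable,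
    integral_map h.measurable_path.aemeasurable hq.aestronglyMeasurable]
  simp only [pathTrig, pathShift]
  simp_rw [← Finset.sum_coe_sort p.1, ← Finset.sum_coe_sort q.1]
  have hU := h.hasGaussianLaw_linComb (fun i : p.1 => p.2.1 i) (fun i : p.1 => (i : ℝ))
  have hV := h.hasGaussianLaw_linComb (fun i : q.1 => q.2.1 i) (fun i : q.1 => (i : ℝ) + t)
  -- Indexing by the disjoint union presents `U + V` and `U - V` as single linear combinations, even
  -- when times coincide.
  have hadd := h.hasGaussianLaw_linComb
    (Sum.elim (fun i : p.1 => p.2.1 i) (fun i : q.1 => q.2.1 i))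
    (Sum.elim (fun i : p.1 => (i : ℝ)) (fun i : q.1 => (i : ℝ) + t))
  have hsub := h.hasGaussianLaw_linComb
    (Sum.elim (fun i : p.1 => p.2.1 i) (fun i : q.1 => -q.2.1 i))
    (Sum.elim (fun i : p.1 => (i : ℝ)) (fun i : q.1 => (i : ℝ) + t))
  simp only [Fintype.sum_sum_type, Sum.elim_inl, Sum.elim_inr] at hadd hsub
  simp_rw [neg_mul, Finset.sum_neg_distrib, ← sub_eq_add_neg] at hsub
  rw [integral_cos_mul_cos_sub hU hV hadd hsub (h.integral_linComb _ _) (h.integral_linComb _ _),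
    h.variance_linComb, h.variance_linComb]
  have := h.gaussian.isProbabilityMeasure
  rw [covariance_fun_sum_fun_sum (fun i => (h.memLp_two _).const_mul _)
    (fun i => (h.memLp_two _).const_mul _)]
  simp_rw [covariance_const_mul_left, covariance_const_mul_right, h.covariance_eq, mul_assoc,
    add_sub_add_right_eq_sub, sub_add_eq_sub_sub]

theorem isWeaklyMixingProcess (h : IsStationaryGaussian X P C)
    (hC1 : ∀ t, |C t| ≤ 1) (hC : ∀ s, IsMeanNull fun t => C (s - t)) : IsWeaklyMixingProcess X P := by
  have hprob := h.isProbabilityMeasure_pathLaw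
  have hν := h.measurePreserving_pathShift
  have hP := h.gaussian.isProbabilityMeasure
  have hX := h.measurable_path
  refine ⟨fun t => ?_, fun A B hA hB => ?_⟩
  · have := (hν t).map_eq
    rwa [pathLaw, Measure.map_map (measurable_pathShift t) hX] at this
  have htrig : ∀ p q, IsMeanNull
      (mixingForm hν (pathTrigLp (pathLaw X P) p) (pathTrigLp (pathLaw X P) q)) := by
    intro p q
    set c : ℝ → ℝ := fun t => ∑ i : p.1, ∑ j : q.1, p.2.1 i * q.2.1 j * C ((i : ℝ) - j - t)
    have hc : IsMeanNull c := IsMeanNull.sum _ fun i _ => IsMeanNull.sum _ fun j _ =>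
      (hC _).const_mul _
    have hcb : ∀ t, |c t| ≤ ∑ i : p.1, ∑ j : q.1, |p.2.1 i * q.2.1 j| := fun t =>
      (Finset.abs_sum_le_sum_abs _ _).trans <| Finset.sum_le_sum fun i _ =>
        (Finset.abs_sum_le_sum_abs _ _).trans <| Finset.sum_le_sum fun j _ => by
          rw [abs_mul]
          exact mul_le_of_le_one_right (abs_nonneg _) (hC1 _)
    have heq : mixingForm hν (pathTrigLp (pathLaw X P) p) (pathTrigLp (pathLaw X P) q)
        = fun t => cosCov ((∑ i : p.1, ∑ j : p.1, p.2.1 i * p.2.1 j * C (i - j))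
          + ∑ i : q.1, ∑ j : q.1, q.2.1 i * q.2.1 j * C (i - j)) p.2.2 q.2.2 (c t) :=
      funext fun t => (mixingForm_pathTrigLp hν p q t).trans (h.integral_pathTrig_mul_sub p q t)
    rw [heq]
    -- The covariance `c t` is bounded in `t`, so the factor `exp |c t|` is absorbed in a constant.
    refine IsMeanNull.of_le_mul ((continuous_cosCov _ _ _).comp hc.continuous) hc
      (Real.exp (∑ i : p.1, ∑ j : q.1, |p.2.1 i * q.2.1 j|)) fun t => ?_
    refine (abs_cosCov_le ?_ _ _ _).trans ?_
    · have h1 := h.variance_linComb (fun i : p.1 => p.2.1 i) (fun i : p.1 => (i : ℝ))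
      have h2 := h.variance_linComb (fun i : q.1 => q.2.1 i) (fun i : q.1 => (i : ℝ))
      rw [← h1, ← h2]
      exact add_nonneg (variance_nonneg _ _) (variance_nonneg _ _)
    · rw [mul_comm]
      gcongr
      exact hcb t
  have hAB := isMeanNull_mixingForm hν htrig
    (indicatorConstLp 2 hA (measure_ne_top _ _) (1 : ℝ))
    (indicatorConstLp 2 hB (measure_ne_top _ _) (1 : ℝ))
  convert! hAB.cesaroTendstoZero_abs using 3 with t
  rw [mixingForm_indicator, pathLaw,
    map_measureReal_apply hX (hA.inter (hB.preimage (measurable_pathShift t))),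
    map_measureReal_apply hX hA, map_measureReal_apply hX hB]
  rfl

end IsStationaryGaussian

/-! ### Grids -/

/-- The `k`-th point of the grid cutting `[a, b]` into `n` equal cells. -/
noncomputable def gridPoint (a b : ℝ) (n k : ℕ) : ℝ := a + (b - a) * (k / n)

/-- The index of the cell of the grid to which `x` belongs. -/
noncomputable def gridIndex (a b : ℝ) (n : ℕ) (x : ℝ) : ℕ := ⌊(x - a) / (b - a) * n⌋₊

lemma tendsto_gridIndex_div {a b x : ℝ} (hab : a < b) (hx : a ≤ x) :
    Tendsto (fun n : ℕ => (gridIndex a b n x : ℝ) / n) atTop (𝓝 ((x - a) / (b - a))) :=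
  (tendsto_nat_floor_mul_div_atTop (div_nonneg (by linarith) (by linarith))).comp
    tendsto_natCast_atTop_atTop

lemma tendsto_gridPoint_gridIndex {a b x : ℝ} (hab : a < b) (hx : a ≤ x) :
    Tendsto (fun n : ℕ => gridPoint a b n (gridIndex a b n x)) atTop (𝓝 x) := by
  have h := ((tendsto_gridIndex_div hab hx).const_mul (b - a)).const_add a
  rwa [mul_div_cancel₀ _ (by linarith : b - a ≠ 0), add_sub_cancel] at h

lemma gridIndex_le {a b x : ℝ} (hab : a < b) (hx : x ≤ b) (n : ℕ) : gridIndex a b n x ≤ n := by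
  refine Nat.floor_le_of_le ?_
  have : (x - a) / (b - a) ≤ 1 := (div_le_one (by linarith)).2 (by linarith)
  exact mul_le_of_le_one_left (Nat.cast_nonneg n) this

lemma gridIndex_lt {a b x : ℝ} (hx : x ∈ Set.Ico a b) {n : ℕ} (hn : 0 < n) :
    gridIndex a b n x < n := by
  have hab : a < b := hx.1.trans_lt hx.2
  refine (Nat.floor_lt' hn.ne').2 ?_
  have : (x - a) / (b - a) < 1 := (div_lt_one (by linarith)).2 (by linarith [hx.2])
  exact mul_lt_of_lt_one_left (by exact_mod_cast hn) this

lemma gridPoint_gridIndex_le {a b x : ℝ} (hx : x ∈ Set.Ico a b) {n : ℕ} (hn : 0 < n) :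
    gridPoint a b n (gridIndex a b n x) ≤ x := by
  have hab : a < b := hx.1.trans_lt hx.2
  have hn' : (0 : ℝ) < n := by exact_mod_cast hn
  have h := Nat.floor_le (a := (x - a) / (b - a) * n)
    (mul_nonneg (div_nonneg (by linarith [hx.1]) (by linarith)) hn'.le)
  rw [← div_le_iff₀ hn', le_div_iff₀ (by linarith)] at h
  rw [gridPoint, gridIndex]
  linarith

lemma lt_gridPoint_gridIndex {a b x : ℝ} (hx : x ∈ Set.Ico a b) {n : ℕ} (hn : 0 < n) :
    x < gridPoint a b n (gridIndex a b n x + 1) := by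
  have hab : a < b := hx.1.trans_lt hx.2
  have hn' : (0 : ℝ) < n := by exact_mod_cast hn
  have h := Nat.lt_floor_add_one ((x - a) / (b - a) * n)
  rw [← lt_div_iff₀ hn', div_lt_iff₀ (by linarith)] at h
  rw [gridPoint, gridIndex]
  push_cast
  linarith

lemma gridPoint_succ_sub (a b : ℝ) (n k : ℕ) :
    gridPoint a b n (k + 1) = gridPoint a b n k + (b - a) / n := by
  rw [gridPoint, gridPoint]; push_cast; ring

/-- On fine grids some nodes near `p` and `q` carry values of opposite strict sign. If all
consecutive products were positive, every node would have the sign of the first. -/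
lemma exists_sign_change_grid {f : ℝ → ℝ} (hf : Continuous f) {a b p q : ℝ} (hab : a < b)
    (hp : p ∈ Set.Icc a b) (hq : q ∈ Set.Icc a b) (hfp : f p < 0) (hfq : 0 < f q) :
    ∀ᶠ n : ℕ in atTop, ∃ k < n, f (gridPoint a b n k) * f (gridPoint a b n (k + 1)) ≤ 0 := by
  have h1 := ((hf.tendsto p).comp (tendsto_gridPoint_gridIndex hab hp.1)).eventually_lt_const hfp
  have h2 := ((hf.tendsto q).comp (tendsto_gridPoint_gridIndex hab hq.1)).eventually_const_lt hfq
  filter_upwards [h1, h2, eventually_gt_atTop 0] with n h1 h2 hn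
  by_contra! hcon
  have hall : ∀ k ≤ n, 0 < f (gridPoint a b n 0) * f (gridPoint a b n k) := by
    intro k
    induction k with
    | zero =>
      intro _
      exact mul_self_pos.2 (left_ne_zero_of_mul (hcon 0 hn).ne')
    | succ k ih =>
      intro hk
      have := mul_pos (ih (by omega)) (hcon k (by omega))
      have hne := left_ne_zero_of_mul (hcon k (by omega)).ne'
      have hsq : 0 < f (gridPoint a b n k) ^ 2 := by positivity
      refine (mul_pos_iff_of_pos_right hsq).1 ?_
      nlinarith
  have h3 := hall _ (gridIndex_le hab hp.2 n)
  have h4 := hall _ (gridIndex_le hab hq.2 n)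
  simp only [Function.comp_apply] at h1 h2
  have h5 : f (gridPoint a b n 0) < 0 := by
    by_contra h
    nlinarith
  nlinarith

lemma measure_eventually_le {Ω : Type*} [MeasurableSpace Ω] {μ : Measure Ω} {A : ℕ → Set Ω}
    {c : ENNReal} (h : ∀ᶠ n in atTop, μ (A n) ≤ c) : μ {ω | ∀ᶠ n in atTop, ω ∈ A n} ≤ c := by
  have heq : {ω | ∀ᶠ n in atTop, ω ∈ A n} = ⋃ N : ℕ, ⋂ n ≥ N, A n := by
    ext ω; simp [eventually_atTop]
  have hmono : Monotone fun N : ℕ => ⋂ n ≥ N, A n := fun N M hNM =>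
    Set.biInter_subset_biInter_left fun n hn => le_trans hNM hn
  rw [heq, hmono.measure_iUnion]
  refine iSup_le fun N => ?_
  obtain ⟨M, hM⟩ := eventually_atTop.1 h
  exact (measure_mono (Set.biInter_subset_of_mem (le_max_left N M))).trans
    (hM _ (le_max_right N M))

/-! ### Sign changes and infima of stationary Gaussian processes -/

lemma gaussianReal_Icc_neg_le (r : ℝ) :
    gaussianReal 0 1 (Set.Icc (-r) r) ≤ ENNReal.ofReal (2 * r) := by
  rw [gaussianReal_apply _ one_ne_zero]
  calc ∫⁻ x in Set.Icc (-r) r, gaussianPDF 0 1 x ≤ ∫⁻ _ in Set.Icc (-r) r, 1 := by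
        refine lintegral_mono fun x => ?_
        rw [gaussianPDF, ENNReal.ofReal_le_one, gaussianPDFReal]
        refine mul_le_one₀ (inv_le_one_of_one_le₀ ?_) (Real.exp_nonneg _)
          (Real.exp_le_one_iff.2 ?_)
        · rw [Real.one_le_sqrt]
          simp only [NNReal.coe_one, mul_one]
          linarith [Real.two_le_pi]
        · simp only [sub_zero, NNReal.coe_one, mul_one]
          have := sq_nonneg x
          exact div_nonpos_of_nonpos_of_nonneg (by linarith) (by norm_num)
    _ = ENNReal.ofReal (2 * r) := by
        rw [setLIntegral_one, Real.volume_Icc]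
        congr 1
        ring

namespace IsStationaryGaussian

variable {Ω : Type*} [MeasurableSpace Ω] {P : Measure Ω} {X : ℝ → Ω → ℝ} {C : ℝ → ℝ}
  {μ : Measure ℝ}

/-- Lets statements about paths staying nonnegative be applied to nonpositive ones. -/
lemma neg (h : IsStationaryGaussian X P C) : IsStationaryGaussian (fun t ω => -X t ω) P C where
  measurable t := (h.measurable t).neg
  gaussian := by simpa using h.gaussian.smul fun _ => (-1 : ℝ)
  centred t := by rw [integral_neg, h.centred, neg_zero]
  covariance_eq s t := by
    rw [← h.covariance_eq s t, covariance_fun_neg_left, covariance_fun_neg_right, neg_neg]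
  continuous_paths := h.continuous_paths.mono fun ω hω => hω.neg

lemma variance_eq (h : IsStationaryGaussian X P C) (s : ℝ) : Var[X s; P] = C 0 := by
  rw [← covariance_self (h.measurable s).aemeasurable, h.covariance_eq, sub_self]

lemma map_eq (h : IsStationaryGaussian X P C) (hC : IsSpectralMeasure μ C) (s : ℝ) :
    P.map (X s) = gaussianReal 0 1 := by
  rw [(h.gaussian.hasGaussianLaw_eval s).map_eq_gaussianReal, h.centred, h.variance_eq, hC.zero,
    Real.toNNReal_one]

lemma covariance_residual (h : IsStationaryGaussian X P C) (hC : IsSpectralMeasure μ C)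
    (s u : ℝ) : cov[X s, fun ω => X u ω - C (u - s) * X s ω; P] = 0 := by
  have := h.gaussian.isProbabilityMeasure
  rw [covariance_fun_sub_right (h.memLp_two s) (h.memLp_two u) ((h.memLp_two s).const_mul _),
    covariance_const_mul_right, h.covariance_eq, h.covariance_eq, sub_self, hC.zero, mul_one,
    ← hC.neg, neg_sub, sub_self]

/-- Gaussian regression on `X s`: the residual path is uncorrelated with `X s` and jointly Gaussian
with it. -/
lemma indepFun_residual (h : IsStationaryGaussian X P C) (hC : IsSpectralMeasure μ C) (s : ℝ) :
    IndepFun (X s) (fun ω u => X u ω - C (u - s) * X s ω) P := by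
  have hG : IsGaussianProcess (Sum.elim (fun _ : Unit => X s)
      fun u ω => X u ω - C (u - s) * X s ω) P := by
    classical
    refine IsGaussianProcess.of_isGaussianProcess h.gaussian fun i => ?_
    rcases i with _ | u
    · exact ⟨{s}, ContinuousLinearMap.proj (⟨s, by simp⟩ : ({s} : Finset ℝ)), fun ω => rfl⟩
    · exact ⟨{s, u}, ContinuousLinearMap.proj (⟨u, by simp⟩ : ({s, u} : Finset ℝ))
        - C (u - s) • ContinuousLinearMap.proj (⟨s, by simp⟩ : ({s, u} : Finset ℝ)),
        fun ω => rfl⟩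
  have hres : ∀ u, Measurable fun ω => X u ω - C (u - s) * X s ω := fun u =>
    (h.measurable u).sub ((h.measurable s).const_mul _)
  have hind := hG.indepFun_of_covariance_eq_zero (fun _ => (h.measurable s).aemeasurable)
    (fun u => (hres u).aemeasurable) fun _ u => h.covariance_residual hC s u
  exact hind.comp (φ := fun f : Unit → ℝ => f ()) (ψ := id) (measurable_pi_apply _) measurable_id

lemma variance_residual (h : IsStationaryGaussian X P C) (hC : IsSpectralMeasure μ C)
    (s u : ℝ) : Var[fun ω => X u ω - C (u - s) * X s ω; P] = 1 - C (u - s) ^ 2 := by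
  have := h.gaussian.isProbabilityMeasure
  rw [variance_fun_sub (h.memLp_two u) ((h.memLp_two s).const_mul _), variance_const_mul,
    covariance_const_mul_right, h.covariance_eq, h.variance_eq, h.variance_eq, hC.zero]
  ring

/-- Write `X u = C (u - s) * X s + W` with `W` independent of `X s`. A nonpositive product forces
`|X s| ≤ 2 * |W|`. Given `W`, this has probability at most `4 * |W|`, because the normal density is
at most `1`, and `E|W|` is at most the standard deviation of `W`. -/
lemma measure_mul_nonpos_le (h : IsStationaryGaussian X P C) (hC : IsSpectralMeasure μ C)
    {s u : ℝ} (hsu : 1 / 2 ≤ C (u - s)) :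
    P {ω | X s ω * X u ω ≤ 0} ≤ ENNReal.ofReal (4 * √(1 - C (u - s) ^ 2)) := by
  have := h.gaussian.isProbabilityMeasure
  set W : Ω → ℝ := fun ω => X u ω - C (u - s) * X s ω with hW
  have hWm : Measurable W := (h.measurable u).sub ((h.measurable s).const_mul _)
  have hW2 : MemLp W 2 P := (h.memLp_two u).sub ((h.memLp_two s).const_mul _)
  have hind : IndepFun W (X s) P :=
    ((h.indepFun_residual hC s).comp measurable_id (measurable_pi_apply u)).symm
  have hsub : {ω | X s ω * X u ω ≤ 0} ⊆ (fun ω => (W ω, X s ω)) ⁻¹' {p | |p.2| ≤ 2 * |p.1|} := by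
    intro ω hω
    simp only [Set.mem_ofPred_eq, Set.mem_preimage] at hω ⊢
    have h1 : X u ω = C (u - s) * X s ω + W ω := by simp [hW]
    rw [h1] at hω
    by_contra! hlt
    have h2 : 0 < |X s ω| := lt_of_le_of_lt (by positivity) hlt
    have h3 : -(|X s ω| * |W ω|) ≤ X s ω * W ω := by rw [← abs_mul]; exact neg_abs_le _
    have h4 : X s ω * X s ω = |X s ω| * |X s ω| := (abs_mul_abs_self _).symm
    nlinarith
  have hmeas : MeasurableSet {p : ℝ × ℝ | |p.2| ≤ 2 * |p.1|} :=
    measurableSet_le (by fun_prop) (by fun_prop)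
  have hpair : P.map (fun ω => (W ω, X s ω)) = (P.map W).prod (gaussianReal 0 1) := by
    rw [← h.map_eq hC s]
    exact (indepFun_iff_map_prod_eq_prod_map_map hWm.aemeasurable
      (h.measurable s).aemeasurable).1 hind
  have habs : Integrable (fun ω => |W ω|) P := (hW2.integrable (by norm_num)).abs
  calc P {ω | X s ω * X u ω ≤ 0}
      ≤ P.map (fun ω => (W ω, X s ω)) {p | |p.2| ≤ 2 * |p.1|} := by
        rw [Measure.map_apply (hWm.prodMk (h.measurable s)) hmeas]
        exact measure_mono hsub
    _ = ∫⁻ w, gaussianReal 0 1 (Set.Icc (-(2 * |w|)) (2 * |w|)) ∂P.map W := by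
        rw [hpair, Measure.prod_apply hmeas]
        refine lintegral_congr fun w => ?_
        congr 1
        ext x
        simp [abs_le]
    _ ≤ ∫⁻ w, ENNReal.ofReal (4 * |w|) ∂P.map W := by
        refine lintegral_mono fun w => (gaussianReal_Icc_neg_le _).trans_eq ?_
        congr 1; ring
    _ = ENNReal.ofReal (∫ ω, 4 * |W ω| ∂P) := by
        rw [lintegral_map (by fun_prop) hWm, ofReal_integral_eq_lintegral_ofReal
          (habs.const_mul 4) (Eventually.of_forall fun ω => by positivity)]
    _ ≤ ENNReal.ofReal (4 * √(1 - C (u - s) ^ 2)) := by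
        rw [integral_const_mul]
        gcongr
        refine Real.le_sqrt_of_sq_le ?_
        have h1 := variance_eq_sub (μ := P) (X := fun ω => |W ω|) hW2.abs
        have h2 := variance_nonneg (fun ω => |W ω|) P
        have h3 := variance_eq_sub hW2
        have h4 : ∫ ω, W ω ∂P = 0 := by
          rw [hW, integral_sub ((h.memLp_two u).integrable (by norm_num))
            (((h.memLp_two s).integrable (by norm_num)).const_mul _), integral_const_mul,
            h.centred, h.centred]
          simp
        rw [hW, h.variance_residual hC, ← hW, h4] at h3
        have h5 : ∫ ω, ((fun ω => |W ω|) ^ 2) ω ∂P = ∫ ω, (W ^ 2) ω ∂P := by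
          simp
        rw [h5] at h1
        linarith

/-- Almost surely, a nonnegative path segment is bounded away from zero. -/
lemma measure_iInf_eq_zero (h : IsStationaryGaussian X P C) (hC : IsSpectralMeasure μ C) {a b : ℝ}
    (hab : ∀ u ∈ Set.Icc a b, 1 / 2 ≤ C (u - a)) :
    P {ω | (∀ q : ℚ, (q : ℝ) ∈ Set.Icc a b → 0 ≤ X q ω) ∧
      ∀ n : ℕ, ∃ q : ℚ, (q : ℝ) ∈ Set.Icc a b ∧ X q ω < 1 / (n + 1)} = 0 := by
  have := h.gaussian.isProbabilityMeasure
  set Y : Ω → ℝ → ℝ := fun ω u => X u ω - C (u - a) * X a ω with hY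
  have hYm : Measurable Y := measurable_pi_lambda _ fun u =>
    (h.measurable u).sub ((h.measurable a).const_mul _)
  set E : Set ((ℝ → ℝ) × ℝ) := {p | (∀ q : ℚ, (q : ℝ) ∈ Set.Icc a b →
      0 ≤ p.1 q + C (q - a) * p.2) ∧
      ∀ n : ℕ, ∃ q : ℚ, (q : ℝ) ∈ Set.Icc a b ∧ p.1 q + C (q - a) * p.2 < 1 / (n + 1)} with hE
  have hev : ∀ q : ℚ, Measurable fun p : (ℝ → ℝ) × ℝ => p.1 q + C (q - a) * p.2 := fun q =>
    ((measurable_pi_apply (q : ℝ)).comp measurable_fst).add (measurable_snd.const_mul _)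
  have hEm : MeasurableSet E := by
    rw [hE, Set.ofPred_and]
    simp only [Set.ofPred_forall, Set.ofPred_exists, Set.ofPred_and]
    refine (MeasurableSet.iInter fun q => MeasurableSet.iInter fun _ =>
      measurableSet_le measurable_const (hev q)).inter (MeasurableSet.iInter fun n =>
      MeasurableSet.iUnion fun q => (MeasurableSet.const _).inter
        (measurableSet_lt (hev q) measurable_const))
  have hset : {ω | (∀ q : ℚ, (q : ℝ) ∈ Set.Icc a b → 0 ≤ X q ω) ∧
      ∀ n : ℕ, ∃ q : ℚ, (q : ℝ) ∈ Set.Icc a b ∧ X q ω < 1 / (n + 1)}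
      = (fun ω => (Y ω, X a ω)) ⁻¹' E := by
    ext ω; simp [hE, hY]
  have hpair : P.map (fun ω => (Y ω, X a ω)) = (P.map Y).prod (gaussianReal 0 1) := by
    rw [← h.map_eq hC a]
    exact (indepFun_iff_map_prod_eq_prod_map_map hYm.aemeasurable
      (h.measurable a).aemeasurable).1 (h.indepFun_residual hC a).symm
  rw [hset, ← Measure.map_apply (hYm.prodMk (h.measurable a)) hEm, hpair,
    Measure.measure_prod_null hEm]
  refine Eventually.of_forall fun y => ?_
  have := nullSingletonClass_gaussianReal (μ := 0) (v := 1) one_ne_zero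
  refine Set.Subsingleton.measure_zero ?_ _
  -- With the residual path `y` fixed, raising `x` by `δ` raises every value on the segment by at
  -- least `δ / 2`. So at most one `x` gives infimum zero, and the normal law of `X a` has no atoms.
  have hlt : ∀ x x' : ℝ, (y, x) ∈ E → (y, x') ∈ E → ¬ x < x' := by
    intro x x' hx hx' hxx'
    obtain ⟨n, hn⟩ := exists_nat_one_div_lt (show 0 < (x' - x) / 2 by linarith)
    obtain ⟨q, hq, hlt⟩ := hx'.2 n
    have h1 := hx.1 q hq
    have h2 := hab q hq
    simp only at hlt h1
    nlinarith
  intro x hx x' hx'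
  exact le_antisymm (not_lt.1 (hlt x' x hx' hx)) (not_lt.1 (hlt x x' hx hx'))

end IsStationaryGaussian

/-- A zero makes the values at rationals arbitrarily small by continuity, so only the nonnegativity
clause can fail. Applied to `f` and `-f`, this excludes zeros without a change of sign. -/
lemma exists_neg_of_zero {f : ℝ → ℝ} (hf : Continuous f) {a b z : ℝ} (hab : a < b)
    (hz : z ∈ Set.Icc a b) (hfz : f z = 0)
    (h : ¬ ((∀ q : ℚ, (q : ℝ) ∈ Set.Icc a b → 0 ≤ f q) ∧
      ∀ n : ℕ, ∃ q : ℚ, (q : ℝ) ∈ Set.Icc a b ∧ f q < 1 / (n + 1))) :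
    ∃ p ∈ Set.Icc a b, f p < 0 := by
  have hsmall : ∀ n : ℕ, ∃ q : ℚ, (q : ℝ) ∈ Set.Icc a b ∧ f q < 1 / (n + 1) := by
    intro n
    have hopen : IsOpen {x | f x < 1 / ((n : ℝ) + 1)} := isOpen_lt hf continuous_const
    have hmem : z ∈ closure (Set.Ioo a b) := by rwa [closure_Ioo hab.ne]
    obtain ⟨y, hy, hy'⟩ := mem_closure_iff.1 hmem _ hopen
      (show f z < 1 / ((n : ℝ) + 1) by rw [hfz]; positivity)
    obtain ⟨q, hq⟩ := Rat.isDenseEmbedding_coe_real.dense.exists_mem_open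
      (hopen.inter isOpen_Ioo) ⟨y, hy, hy'⟩
    exact ⟨q, Set.Ioo_subset_Icc_self hq.2, hq.1⟩
  by_contra! hcon
  exact h ⟨fun q hq => hcon q hq, hsmall⟩

/-! ### Counting points with grids -/

open Classical in
/-- The number of cells of the grid cutting `[a, b)` into `n` cells which meet `Z`. -/
noncomputable def hitCount (Z : Set ℝ) (a b : ℝ) (n : ℕ) : ℕ :=
  ∑ k ∈ Finset.range n,
    if (Z ∩ Set.Ico (gridPoint a b n k) (gridPoint a b n (k + 1))).Nonempty then 1 else 0

lemma mem_image_gridIndex_iff {Z : Set ℝ} {a b : ℝ} (hab : a < b) {n k : ℕ} (hk : k < n) :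
    k ∈ gridIndex a b n '' (Z ∩ Set.Ico a b) ↔
      (Z ∩ Set.Ico (gridPoint a b n k) (gridPoint a b n (k + 1))).Nonempty := by
  have hn : 0 < n := by omega
  have hn' : (0 : ℝ) < n := by exact_mod_cast hn
  constructor
  · rintro ⟨x, ⟨hxZ, hx⟩, rfl⟩
    exact ⟨x, hxZ, gridPoint_gridIndex_le hx hn, lt_gridPoint_gridIndex hx hn⟩
  · rintro ⟨x, hxZ, hx1, hx2⟩
    have hba : 0 < b - a := by linarith
    have hk1 : ((k + 1 : ℕ) : ℝ) / n ≤ 1 := by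
      rw [div_le_one hn']; exact_mod_cast hk
    have h1 : (k : ℝ) / n ≤ (x - a) / (b - a) := by
      rw [le_div_iff₀ hba]; rw [gridPoint] at hx1; linarith
    have h2 : (x - a) / (b - a) < ((k + 1 : ℕ) : ℝ) / n := by
      rw [div_lt_iff₀ hba]; rw [gridPoint] at hx2; linarith
    have h0 : 0 ≤ (x - a) / (b - a) := le_trans (by positivity) h1
    refine ⟨x, ⟨hxZ, ?_, ?_⟩, ?_⟩
    · have := mul_nonneg h0 hba.le
      rw [div_mul_cancel₀ _ hba.ne'] at this
      linarith
    · have := h2.trans_le hk1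
      rw [div_lt_one hba] at this
      linarith
    · rw [gridIndex, Nat.floor_eq_iff (mul_nonneg h0 hn'.le)]
      rw [div_le_iff₀ hn'] at h1
      rw [lt_div_iff₀ hn'] at h2
      push_cast at h2
      exact ⟨h1, h2⟩

lemma encard_image_gridIndex {Z : Set ℝ} {a b : ℝ} (hab : a < b) {n : ℕ} (hn : 0 < n) :
    (gridIndex a b n '' (Z ∩ Set.Ico a b)).encard = hitCount Z a b n := by
  classical
  have : gridIndex a b n '' (Z ∩ Set.Ico a b) = ((Finset.range n).filter fun k =>
      (Z ∩ Set.Ico (gridPoint a b n k) (gridPoint a b n (k + 1))).Nonempty : Finset ℕ) := by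
    ext k
    rw [Finset.coe_filter]
    constructor
    · intro hk
      have hkn : k < n := by
        obtain ⟨x, ⟨_, hx⟩, rfl⟩ := hk
        exact gridIndex_lt hx hn
      exact ⟨Finset.mem_range.2 hkn, (mem_image_gridIndex_iff hab hkn).1 hk⟩
    · rintro ⟨hkn, hk⟩
      exact (mem_image_gridIndex_iff hab (Finset.mem_range.1 hkn)).2 hk
  rw [this, Set.encard_coe_eq_coe_finsetCard, hitCount, Finset.sum_boole]
  congr

lemma hitCount_le_encard {Z : Set ℝ} {a b : ℝ} (hab : a < b) {n : ℕ} (hn : 0 < n) :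
    (hitCount Z a b n : ℕ∞) ≤ (Z ∩ Set.Ico a b).encard := by
  rw [← encard_image_gridIndex hab hn]
  exact Set.encard_image_le _ _

/-- The rescaled cell index of a point converges to its relative position in `[a, b)`, so finitely
many distinct points end up in distinct cells. -/
lemma eventually_le_hitCount {Z : Set ℝ} {a b : ℝ} (hab : a < b) {m : ℕ}
    (hm : (m : ℕ∞) ≤ (Z ∩ Set.Ico a b).encard) : ∀ᶠ n in atTop, m ≤ hitCount Z a b n := by
  obtain ⟨F, hFZ, hF⟩ := Set.exists_subset_encard_eq hm
  have hfin : F.Finite := Set.finite_of_encard_eq_coe hF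
  have hinj : ∀ᶠ n in atTop, ∀ x ∈ F, ∀ y ∈ F, x ≠ y → gridIndex a b n x ≠ gridIndex a b n y := by
    rw [eventually_all_finite hfin]
    intro x hx
    rw [eventually_all_finite hfin]
    intro y hy
    rw [eventually_imp_distrib_left]
    intro hxy
    have hne : (x - a) / (b - a) ≠ (y - a) / (b - a) := by
      intro h
      rw [div_left_inj' (by linarith)] at h
      exact hxy (by linarith)
    have h1 := (tendsto_gridIndex_div hab (hFZ hx).2.1).prodMk_nhds
      (tendsto_gridIndex_div hab (hFZ hy).2.1)
    have h2 := h1.eventually (isOpen_ne_fun continuous_fst continuous_snd |>.mem_nhds hne)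
    exact h2.mono fun n hn heq => hn (by simp [heq])
  filter_upwards [hinj, eventually_gt_atTop 0] with n hn hn0
  have h3 : Set.InjOn (gridIndex a b n) F := fun x hx y hy hxy => by
    by_contra hne
    exact hn x hx y hy hne hxy
  have h4 : (m : ℕ∞) ≤ hitCount Z a b n := by
    rw [← encard_image_gridIndex hab hn0, ← hF, ← h3.encard_image]
    exact Set.encard_mono (Set.image_mono hFZ)
  exact_mod_cast h4

/-- Cell counts never exceed the number of points and eventually reach every finite lower bound for
it. The index `n + 1` leaves out the grid without cells. -/
lemma encard_inter_Ico_eq_iSup (Z : Set ℝ) {a b : ℝ} (hab : a < b) :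
    (((Z ∩ Set.Ico a b).encard : ℕ∞) : ENNReal) = ⨆ n : ℕ, (hitCount Z a b (n + 1) : ENNReal) := by
  refine le_antisymm ?_ (iSup_le fun n => ?_)
  · refine ENNReal.le_of_forall_nnreal_lt fun r hr => ?_
    obtain ⟨m, hm⟩ := exists_nat_ge r
    have hmem : ∃ m : ℕ, (r : ENNReal) ≤ m ∧ (m : ℕ∞) ≤ (Z ∩ Set.Ico a b).encard := by
      rcases eq_or_ne (Z ∩ Set.Ico a b).encard ⊤ with htop | hne
      · exact ⟨m, by exact_mod_cast hm, by rw [htop]; exact le_top⟩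
      · obtain ⟨j, hj⟩ := ENat.ne_top_iff_exists.1 hne
        refine ⟨j, ?_, hj.le⟩
        rw [← hj] at hr
        simpa using hr.le
    obtain ⟨j, hj, hjZ⟩ := hmem
    obtain ⟨n, hn, hn0⟩ := ((eventually_le_hitCount hab hjZ).and (eventually_gt_atTop 0)).exists
    refine hj.trans (le_iSup_of_le (n - 1) ?_)
    rw [Nat.sub_add_cancel hn0]
    exact_mod_cast hn
  · have := hitCount_le_encard (Z := Z) hab n.succ_pos
    exact_mod_cast ENat.toENNReal_le.2 this

/-! ### Measurability of the zero counts of a continuous process -/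

section

variable {Ω : Type*} [MeasurableSpace Ω] {X : ℝ → Ω → ℝ}

lemma measurableSet_hit_Icc (hX : ∀ t, Measurable (X t)) (hc : ∀ ω, Continuous fun t => X t ω)
    (c d : ℝ) : MeasurableSet {ω | ∃ t ∈ Set.Icc c d, X t ω = 0} := by
  -- For `c < d`, compactness turns a zero into arbitrarily small values at rational times. A
  -- one-point interval may contain no rational and is treated apart.
  rcases lt_trichotomy c d with hcd | rfl | hcd
  · have heq : {ω | ∃ t ∈ Set.Icc c d, X t ω = 0} = ⋂ n : ℕ, ⋃ q : ℚ,
        {ω | (q : ℝ) ∈ Set.Icc c d ∧ |X q ω| < 1 / ((n : ℝ) + 1)} := by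
      ext ω
      simp only [Set.mem_iInter, Set.mem_iUnion, Set.mem_ofPred_eq]
      constructor
      · rintro ⟨z, hz, hz0⟩ n
        have hopen : IsOpen {x | |X x ω| < 1 / ((n : ℝ) + 1)} :=
          isOpen_lt (hc ω).abs continuous_const
        have hmem : z ∈ closure (Set.Ioo c d) := by rwa [closure_Ioo hcd.ne]
        obtain ⟨y, hy, hy'⟩ := mem_closure_iff.1 hmem _ hopen
          (show |X z ω| < 1 / ((n : ℝ) + 1) by rw [hz0, abs_zero]; positivity)
        obtain ⟨q, hq⟩ := Rat.isDenseEmbedding_coe_real.dense.exists_mem_open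
          (hopen.inter isOpen_Ioo) ⟨y, hy, hy'⟩
        exact ⟨q, Set.Ioo_subset_Icc_self hq.2, hq.1⟩
      · intro h
        obtain ⟨z, hz, hmin⟩ := isCompact_Icc.exists_isMinOn (Set.nonempty_Icc.2 hcd.le)
          (hc ω).abs.continuousOn
        refine ⟨z, hz, ?_⟩
        by_contra hne
        obtain ⟨n, hn⟩ := exists_nat_one_div_lt (abs_pos.2 hne)
        obtain ⟨q, hq, hlt⟩ := h n
        have := hmin hq
        simp only [Set.mem_ofPred_eq] at this
        linarith
    rw [heq]
    exact MeasurableSet.iInter fun n => MeasurableSet.iUnion fun q =>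
      (MeasurableSet.const _).inter (measurableSet_lt (hX q).abs measurable_const)
  · simpa using measurableSet_eq_fun (hX c) measurable_const
  · simp [Set.Icc_eq_empty_of_lt hcd]

lemma measurableSet_hit_Ico (hX : ∀ t, Measurable (X t)) (hc : ∀ ω, Continuous fun t => X t ω)
    (c d : ℝ) : MeasurableSet {ω | (zeroSet X ω ∩ Set.Ico c d).Nonempty} := by
  have heq : {ω | (zeroSet X ω ∩ Set.Ico c d).Nonempty}
      = ⋃ n : ℕ, {ω | ∃ t ∈ Set.Icc c (d - 1 / ((n : ℝ) + 1)), X t ω = 0} := by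
    ext ω
    simp only [Set.mem_iUnion, Set.mem_ofPred_eq]
    constructor
    · rintro ⟨t, ht, htc, htd⟩
      obtain ⟨n, hn⟩ := exists_nat_one_div_lt (sub_pos.2 htd)
      exact ⟨n, t, ⟨htc, by linarith⟩, ht⟩
    · rintro ⟨n, t, ⟨htc, htd⟩, ht⟩
      have : 0 < 1 / ((n : ℝ) + 1) := by positivity
      exact ⟨t, ht, htc, by linarith⟩
  rw [heq]
  exact MeasurableSet.iUnion fun n => measurableSet_hit_Icc hX hc _ _

lemma measurable_hitCount (hX : ∀ t, Measurable (X t)) (hc : ∀ ω, Continuous fun t => X t ω)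
    (a b : ℝ) (n : ℕ) : Measurable fun ω => hitCount (zeroSet X ω) a b n :=
  Finset.measurable_sum _ fun _ _ => Measurable.ite (measurableSet_hit_Ico hX hc _ _)
    measurable_const measurable_const

lemma measurable_encard_zeroSet_Ico (hX : ∀ t, Measurable (X t))
    (hc : ∀ ω, Continuous fun t => X t ω) (a b : ℝ) :
    Measurable fun ω => (((zeroSet X ω ∩ Set.Ico a b).encard : ℕ∞) : ENNReal) := by
  rcases lt_or_ge a b with hab | hab
  · simp_rw [encard_inter_Ico_eq_iSup _ hab]
    exact Measurable.iSup fun n => (measurable_from_nat (f := fun m : ℕ => (m : ENNReal))).comp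
      (measurable_hitCount hX hc _ _ _)
  · simp [Set.Ico_eq_empty_of_le hab]

end

/-! ### The zero set is almost surely locally finite -/

namespace IsStationaryGaussian

variable {Ω : Type*} [MeasurableSpace Ω] {P : Measure Ω} {X : ℝ → Ω → ℝ} {C : ℝ → ℝ}
  {μ : Measure ℝ} {K : ℝ}

/-- Almost surely a zero in `[a, b]` produces a sign change along every fine enough grid. Each of
the `n` cells contributes at most `4 * K * (b - a) / n`, so the union bound is free of `n`. -/
lemma measure_hit_le (h : IsStationaryGaussian X P C) (hC : IsSpectralMeasure μ C)
    (hc : ∀ ω, Continuous fun t => X t ω) (hK0 : 0 ≤ K)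
    (hK : ∀ u, 1 - C u ^ 2 ≤ K ^ 2 * u ^ 2) {a b : ℝ} (hab : a < b)
    (hCab : ∀ u ∈ Set.Icc 0 (b - a), 1 / 2 ≤ C u) :
    P {ω | ∃ t ∈ Set.Icc a b, X t ω = 0} ≤ ENNReal.ofReal (4 * K * (b - a)) := by
  set S : ℕ → Set Ω := fun n => ⋃ k ∈ Finset.range n,
    {ω | X (gridPoint a b n k) ω * X (gridPoint a b n (k + 1)) ω ≤ 0} with hS
  have hSle : ∀ᶠ n in atTop, P (S n) ≤ ENNReal.ofReal (4 * K * (b - a)) := by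
    filter_upwards [eventually_gt_atTop 0] with n hn
    have hn' : (0 : ℝ) < n := by exact_mod_cast hn
    have hcell : ∀ k ∈ Finset.range n,
        P {ω | X (gridPoint a b n k) ω * X (gridPoint a b n (k + 1)) ω ≤ 0}
          ≤ ENNReal.ofReal (4 * (K * ((b - a) / n))) := by
      intro k _
      have hpos : 0 ≤ (b - a) / n := div_nonneg (by linarith) hn'.le
      have hdiff : gridPoint a b n (k + 1) - gridPoint a b n k = (b - a) / n := by
        rw [gridPoint_succ_sub]; ring
      refine (h.measure_mul_nonpos_le hC ?_).trans ?_
      · rw [hdiff]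
        exact hCab _ ⟨hpos, div_le_self (by linarith) (by exact_mod_cast hn)⟩
      · rw [hdiff]
        gcongr
        refine Real.sqrt_le_iff.2 ⟨by positivity, ?_⟩
        rw [mul_pow]
        exact hK _
    calc P (S n) ≤ ∑ k ∈ Finset.range n,
          P {ω | X (gridPoint a b n k) ω * X (gridPoint a b n (k + 1)) ω ≤ 0} :=
          measure_biUnion_finset_le _ _
      _ ≤ ∑ k ∈ Finset.range n, ENNReal.ofReal (4 * (K * ((b - a) / n))) :=
          Finset.sum_le_sum hcell
      _ = ENNReal.ofReal (4 * K * (b - a)) := by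
          rw [Finset.sum_const, Finset.card_range, nsmul_eq_mul, ← ENNReal.ofReal_natCast n,
            ← ENNReal.ofReal_mul hn'.le]
          congr 1
          field_simp
  have hE := h.measure_iInf_eq_zero hC (a := a) (b := b) fun u hu =>
    hCab _ ⟨by linarith [hu.1], by linarith [hu.2]⟩
  have hE' := h.neg.measure_iInf_eq_zero hC (a := a) (b := b) fun u hu =>
    hCab _ ⟨by linarith [hu.1], by linarith [hu.2]⟩
  refine le_trans ?_ (measure_eventually_le hSle)
  refine measure_mono_ae ?_
  rw [measure_eq_zero_iff_ae_notMem] at hE hE'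
  filter_upwards [hE, hE'] with ω h1 h2
  rintro ⟨z, hz, hz0⟩
  obtain ⟨p, hp, hfp⟩ := exists_neg_of_zero (hc ω) hab hz hz0 h1
  obtain ⟨q, hq, hfq⟩ := exists_neg_of_zero (hc ω).neg hab hz (by simp [hz0]) h2
  refine (exists_sign_change_grid (hc ω) hab hp hq hfp (neg_lt_zero.1 hfq)).mono fun n hn => ?_
  obtain ⟨k, hk, hle⟩ := hn
  exact Set.mem_biUnion (Finset.mem_coe.2 (Finset.mem_range.2 hk)) hle

/-- Once the cells are short enough for `measure_hit_le`, the mean hit count is at most `4 * K * (b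
- a)`. With infinitely many zeros the hit counts eventually pass every `m + 1`, an event of
probability `O(1 / m)` by Markov's inequality. -/
lemma measure_encard_eq_top (h : IsStationaryGaussian X P C) (hC : IsSpectralMeasure μ C)
    (hc : ∀ ω, Continuous fun t => X t ω) (hK0 : 0 ≤ K)
    (hK : ∀ u, 1 - C u ^ 2 ≤ K ^ 2 * u ^ 2) {a b : ℝ} (hab : a < b) :
    P {ω | (zeroSet X ω ∩ Set.Ico a b).encard = ⊤} = 0 := by
  obtain ⟨δ, hδ, hCδ⟩ : ∃ δ > 0, ∀ u ∈ Set.Icc 0 δ, 1 / 2 ≤ C u := by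
    have h1 : ∀ᶠ u in 𝓝 (0 : ℝ), 1 / 2 < C u :=
      (hC.continuous.tendsto 0).eventually_const_lt (by rw [hC.zero]; norm_num)
    obtain ⟨ε, hε, hball⟩ := Metric.eventually_nhds_iff.1 h1
    refine ⟨ε / 2, half_pos hε, fun u hu => (hball ?_).le⟩
    rw [Real.dist_0_eq_abs, abs_of_nonneg hu.1]
    linarith [hu.2]
  have hmean : ∀ᶠ n : ℕ in atTop,
      ∫⁻ ω, (hitCount (zeroSet X ω) a b n : ENNReal) ∂P ≤ ENNReal.ofReal (4 * K * (b - a)) := by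
    have hlim : Tendsto (fun n : ℕ => (b - a) / n) atTop (𝓝 0) :=
      tendsto_const_div_atTop_nhds_zero_nat _
    filter_upwards [eventually_gt_atTop 0, hlim.eventually_lt_const hδ] with n hn hnδ
    have hn' : (0 : ℝ) < n := by exact_mod_cast hn
    have hpos : 0 < (b - a) / n := div_pos (by linarith) hn'
    classical
    calc ∫⁻ ω, (hitCount (zeroSet X ω) a b n : ENNReal) ∂P
        = ∑ k ∈ Finset.range n, P {ω | (zeroSet X ω ∩
            Set.Ico (gridPoint a b n k) (gridPoint a b n (k + 1))).Nonempty} := by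
          rw [← Finset.sum_congr rfl fun k _ => lintegral_indicator_one
            (measurableSet_hit_Ico h.measurable hc _ _), ← lintegral_finsetSum _ fun k _ =>
            measurable_one.indicator (measurableSet_hit_Ico h.measurable hc _ _)]
          refine lintegral_congr fun ω => ?_
          rw [hitCount]
          push_cast
          refine Finset.sum_congr rfl fun k _ => ?_
          simp [Set.indicator_apply]
      _ ≤ ∑ k ∈ Finset.range n, ENNReal.ofReal (4 * K * ((b - a) / n)) := by
          refine Finset.sum_le_sum fun k _ => ?_
          have hdiff : gridPoint a b n (k + 1) - gridPoint a b n k = (b - a) / n := by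
            rw [gridPoint_succ_sub]; ring
          rw [← hdiff]
          refine le_trans (measure_mono ?_) (h.measure_hit_le hC hc hK0 hK (by linarith) ?_)
          · rintro ω ⟨t, ht, ht'⟩
            exact ⟨t, Set.Ico_subset_Icc_self ht', ht⟩
          · rw [hdiff]
            exact fun u hu => hCδ u ⟨hu.1, hu.2.trans hnδ.le⟩
      _ = ENNReal.ofReal (4 * K * (b - a)) := by
          rw [Finset.sum_const, Finset.card_range, nsmul_eq_mul, ← ENNReal.ofReal_natCast n,
            ← ENNReal.ofReal_mul hn'.le]
          congr 1
          field_simp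
  have hbound : ∀ m : ℕ, P {ω | (zeroSet X ω ∩ Set.Ico a b).encard = ⊤}
      ≤ ENNReal.ofReal (4 * K * (b - a) / (m + 1 : ℕ)) := by
    intro m
    refine le_trans (measure_mono (t := {ω | ∀ᶠ n in atTop,
      ω ∈ {ω | ((m + 1 : ℕ) : ENNReal) ≤ hitCount (zeroSet X ω) a b n}}) fun ω hω => ?_)
      (measure_eventually_le ?_)
    · refine (eventually_le_hitCount (Z := zeroSet X ω) hab (m := m + 1) ?_).mono fun n hn => ?_
      · rw [show (zeroSet X ω ∩ Set.Ico a b).encard = ⊤ from hω]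
        exact le_top
      · exact (Nat.cast_le (α := ENNReal)).2 hn
    · filter_upwards [hmean] with n hn
      refine (meas_ge_le_lintegral_div ?_ (by simp) (by simp)).trans ?_
      · exact ((measurable_from_nat (f := fun m : ℕ => (m : ENNReal))).comp
          (measurable_hitCount h.measurable hc _ _ _)).aemeasurable
      · rw [ENNReal.ofReal_div_of_pos (by positivity), ENNReal.ofReal_natCast]
        gcongr
  have hlim : Tendsto (fun m : ℕ => ENNReal.ofReal (4 * K * (b - a) / (m + 1 : ℕ))) atTop
      (𝓝 0) := by
    have := (tendsto_const_div_atTop_nhds_zero_nat (4 * K * (b - a))).comp (tendsto_add_atTop_nat 1)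
    simpa using ENNReal.tendsto_ofReal this
  exact le_antisymm (ge_of_tendsto' hlim hbound) bot_le

end IsStationaryGaussian

/-! ### Measurability of the zero configuration -/

lemma isLocallyFiniteSet_iff_encard {S : Set ℝ} :
    IsLocallyFiniteSet S ↔ ∀ N : ℕ, (S ∩ Set.Ico (-(N : ℝ)) N).encard ≠ ⊤ := by
  constructor
  · intro h N
    rw [Set.encard_ne_top_iff]
    exact (h (-N) N).subset (Set.inter_subset_inter_right _ Set.Ico_subset_Icc_self)
  · intro h a b
    obtain ⟨N, hN⟩ := exists_nat_gt (max (-a) b)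
    refine (Set.encard_ne_top_iff.1 (h N)).subset (Set.inter_subset_inter_right _ fun x hx => ?_)
    exact ⟨by linarith [hx.1, le_max_left (-a) b], by linarith [hx.2, le_max_right (-a) b]⟩

lemma IsLocallyFiniteSet.countable {S : Set ℝ} (h : IsLocallyFiniteSet S) : S.Countable := by
  have : S ⊆ ⋃ N : ℕ, S ∩ Set.Icc (-(N : ℝ)) N := fun x hx => by
    obtain ⟨N, hN⟩ := exists_nat_ge |x|
    exact Set.mem_iUnion.2 ⟨N, hx, abs_le.1 hN⟩
  exact (Set.countable_iUnion fun N : ℕ => (h (-N) N).countable).mono this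

lemma zeroConfiguration_val {Ω : Type*} {X : ℝ → Ω → ℝ} {ω : Ω}
    (h : IsLocallyFiniteSet (zeroSet X ω)) : (zeroConfiguration X ω).1 = zeroSet X ω :=
  congrArg Subtype.val (dif_pos h : zeroConfiguration X ω = ⟨zeroSet X ω, h⟩)

lemma zeroConfiguration_val_of_not {Ω : Type*} {X : ℝ → Ω → ℝ} {ω : Ω}
    (h : ¬ IsLocallyFiniteSet (zeroSet X ω)) : (zeroConfiguration X ω).1 = ∅ :=
  congrArg Subtype.val (dif_neg h : zeroConfiguration X ω = ⟨∅, by intro a b; simp⟩)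

lemma zeroConfiguration_congr {Ω : Type*} {X Y : ℝ → Ω → ℝ} {ω : Ω} (h : ∀ t, X t ω = Y t ω) :
    zeroConfiguration X ω = zeroConfiguration Y ω :=
  congrArg (zeroConfiguration fun t (f : ℝ → ℝ) => f t)
    (funext h : (fun t => X t ω) = fun t => Y t ω)

section

variable {Ω : Type*} [MeasurableSpace Ω] {X : ℝ → Ω → ℝ}

lemma measurableSet_isLocallyFiniteSet_zeroSet (hX : ∀ t, Measurable (X t))
    (hc : ∀ ω, Continuous fun t => X t ω) :
    MeasurableSet {ω | IsLocallyFiniteSet (zeroSet X ω)} := by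
  have heq : {ω | IsLocallyFiniteSet (zeroSet X ω)} = ⋂ N : ℕ, {ω |
      (((zeroSet X ω ∩ Set.Ico (-(N : ℝ)) N).encard : ℕ∞) : ENNReal) ≠ ⊤} := by
    ext ω
    simp [isLocallyFiniteSet_iff_encard]
  rw [heq]
  exact MeasurableSet.iInter fun N =>
    (measurable_encard_zeroSet_Ico hX hc _ _ (measurableSet_singleton ⊤)).compl

lemma measurable_encard_zeroConfiguration_Ico (hX : ∀ t, Measurable (X t))
    (hc : ∀ ω, Continuous fun t => X t ω) (a b : ℝ) :
    Measurable fun ω => ((((zeroConfiguration X ω).1 ∩ Set.Ico a b).encard : ℕ∞) : ENNReal) := by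
  classical
  have heq : (fun ω => ((((zeroConfiguration X ω).1 ∩ Set.Ico a b).encard : ℕ∞) : ENNReal))
      = fun ω => if IsLocallyFiniteSet (zeroSet X ω) then
        (((zeroSet X ω ∩ Set.Ico a b).encard : ℕ∞) : ENNReal) else 0 := by
    ext ω
    split_ifs with h
    · rw [zeroConfiguration_val h]
    · rw [zeroConfiguration_val_of_not h]; simp
  rw [heq]
  exact Measurable.ite (measurableSet_isLocallyFiniteSet_zeroSet hX hc)
    (measurable_encard_zeroSet_Ico hX hc a b) measurable_const

lemma measurable_encard_zeroConfiguration (hX : ∀ t, Measurable (X t))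
    (hc : ∀ ω, Continuous fun t => X t ω) {A : Set ℝ} (hA : MeasurableSet A) :
    Measurable fun ω => ((((zeroConfiguration X ω).1 ∩ A).encard : ℕ∞) : ENNReal) := by
  have hS : ∀ ω, MeasurableSet (zeroConfiguration X ω).1 := fun ω =>
    (zeroConfiguration X ω).2.countable.measurableSet
  -- Truncation to `[-N, N)` makes the counting measures finite, so measurability extends from
  -- half-open intervals to Borel sets by a π-system argument. The supremum over `N` removes the
  -- truncation.
  set κ : ℕ → Ω → Measure ℝ := fun N ω =>
    Measure.count.restrict ((zeroConfiguration X ω).1 ∩ Set.Ico (-(N : ℝ)) N) with hκ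
  have hκapp : ∀ N ω {B : Set ℝ}, MeasurableSet B → κ N ω B
      = (((B ∩ ((zeroConfiguration X ω).1 ∩ Set.Ico (-(N : ℝ)) N)).encard : ℕ∞) : ENNReal) := by
    intro N ω B hB
    rw [hκ]
    simp only
    rw [Measure.restrict_apply hB,
      Measure.count_apply (hB.inter ((hS ω).inter measurableSet_Ico))]
  have hκfin : ∀ N ω, IsFiniteMeasure (κ N ω) := fun N ω => ⟨by
    rw [hκapp N ω MeasurableSet.univ, Set.univ_inter]
    have := isLocallyFiniteSet_iff_encard.1 (zeroConfiguration X ω).2 N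
    simpa [lt_top_iff_ne_top] using this⟩
  have hκIco : ∀ N a b, Measurable fun ω => κ N ω (Set.Ico a b) := by
    intro N a b
    simp_rw [hκapp N _ measurableSet_Ico, Set.inter_left_comm (Set.Ico a b), Set.Ico_inter_Ico]
    exact measurable_encard_zeroConfiguration_Ico hX hc _ _
  have hκm : ∀ N, Measurable (κ N) := by
    intro N
    refine Measurable.measure_of_isPiSystem
      ((borel_eq_generateFrom_Ico ℝ) ▸ (BorelSpace.measurable_eq (α := ℝ)))
      (by simpa using isPiSystem_Ico (id : ℝ → ℝ) id) ?_ ?_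
    · rintro _ ⟨a, b, _, rfl⟩
      exact hκIco N a b
    · simp_rw [hκapp N _ MeasurableSet.univ, Set.univ_inter]
      exact measurable_encard_zeroConfiguration_Ico hX hc _ _
  have hsup : ∀ ω, ((((zeroConfiguration X ω).1 ∩ A).encard : ℕ∞) : ENNReal)
      = ⨆ N, κ N ω A := by
    intro ω
    have hmono : Monotone fun N : ℕ => A ∩ ((zeroConfiguration X ω).1 ∩ Set.Ico (-(N : ℝ)) N) := by
      intro N M hNM
      have : (N : ℝ) ≤ M := by exact_mod_cast hNM
      exact Set.inter_subset_inter_right _ (Set.inter_subset_inter_right _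
        (Set.Ico_subset_Ico (by linarith) this))
    have hunion : (zeroConfiguration X ω).1 ∩ A
        = ⋃ N : ℕ, A ∩ ((zeroConfiguration X ω).1 ∩ Set.Ico (-(N : ℝ)) N) := by
      rw [← Set.inter_iUnion, ← Set.inter_iUnion, Set.iUnion_eq_univ_iff.2, Set.inter_univ,
        Set.inter_comm]
      intro x
      obtain ⟨N, hN⟩ := exists_nat_gt |x|
      exact ⟨N, (abs_lt.1 hN).1.le, (abs_lt.1 hN).2⟩
    rw [← Measure.count_apply ((hS ω).inter hA), hunion, hmono.measure_iUnion]
    refine iSup_congr fun N => ?_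
    rw [hκapp N ω hA, Measure.count_apply (hA.inter ((hS ω).inter measurableSet_Ico))]
  simp_rw [hsup]
  exact Measurable.iSup fun N => (Measure.measurable_coe hA).comp (hκm N)

lemma measurable_zeroConfiguration (hX : ∀ t, Measurable (X t))
    (hc : ∀ ω, Continuous fun t => X t ω) : Measurable (zeroConfiguration X) := by
  rw [measurable_iff_comap_le, Configuration.instMeasurableSpace, MeasurableSpace.comap_iSup]
  refine iSup_le fun A => ?_
  rw [MeasurableSpace.comap_iSup]
  refine iSup_le fun hA => ?_
  rw [MeasurableSpace.comap_comp, ← measurable_iff_comap_le]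
  refine @measurable_to_countable' ℕ∞ Ω ⊤ _ _ _ fun x => ?_
  have h := measurable_encard_zeroConfiguration hX hc hA (measurableSet_singleton (x : ENNReal))
  convert! h using 1
  ext ω
  simp [Configuration.count]

end

/-! ### Zero configurations of translated paths -/

lemma zeroSet_translate {Ω : Type*} (X : ℝ → Ω → ℝ) (t : ℝ) (ω : Ω) :
    zeroSet (fun s => X (s - t)) ω = (fun x => x + t) '' zeroSet X ω := by
  ext s
  simp only [zeroSet, Set.mem_ofPred_eq, Set.mem_image]
  exact ⟨fun h => ⟨s - t, h, by ring⟩, by rintro ⟨x, hx, rfl⟩; simpa using hx⟩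

/-- Holds for every `ω`: translation preserves failure of local finiteness, and the default empty
configuration is translation invariant. -/
lemma translate_zeroConfiguration {Ω : Type*} (X : ℝ → Ω → ℝ) (t : ℝ) (ω : Ω) :
    (zeroConfiguration X ω).translate t = zeroConfiguration (fun s => X (s - t)) ω := by
  refine Subtype.ext ?_
  change (fun x => x + t) '' (zeroConfiguration X ω).1 = _
  by_cases h : IsLocallyFiniteSet (zeroSet X ω)
  · have h' : IsLocallyFiniteSet (zeroSet (fun s => X (s - t)) ω) := by
      rw [zeroSet_translate]; exact isLocallyFiniteSet_translate h t
    rw [zeroConfiguration_val h, zeroConfiguration_val h', zeroSet_translate]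
  · have h' : ¬ IsLocallyFiniteSet (zeroSet (fun s => X (s - t)) ω) := by
      rw [zeroSet_translate]
      intro h'
      refine h ?_
      have := isLocallyFiniteSet_translate h' (-t)
      rwa [Set.image_image, show (fun x : ℝ => x + t + -t) = id from funext fun x => by simp,
        Set.image_id] at this
    rw [zeroConfiguration_val_of_not h, zeroConfiguration_val_of_not h', Set.image_empty]

/-- Events of the zero configuration of a continuous path are events of the product `σ`-algebra. -/
lemma exists_measurableSet_zeroConfiguration_iff {A : Set Configuration} (hA : MeasurableSet A) :
    ∃ A' : Set (ℝ → ℝ), MeasurableSet A' ∧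
      ∀ (Ω : Type*) (X : ℝ → Ω → ℝ) (ω : Ω), (Continuous fun t => X t ω) →
        (zeroConfiguration X ω ∈ A ↔ (fun s => X s ω) ∈ A') := by
  -- The set of continuous paths is not measurable in the product `σ`-algebra, so measurability is
  -- proved on this subtype and `A'` is any measurable set with the right trace.
  have hm := measurable_zeroConfiguration (Ω := {f : ℝ → ℝ // Continuous f})
    (X := fun t f => f.1 t) (fun t => (measurable_pi_apply t).comp measurable_subtype_coe)
    fun f => f.2
  obtain ⟨A', hA', heq⟩ := MeasurableSpace.measurableSet_comap.1 (hm hA)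
  refine ⟨A', hA', fun Ω X ω hω => ?_⟩
  have h := Set.ext_iff.1 heq ⟨fun t => X t ω, hω⟩
  exact h.symm

namespace IsStationaryGaussian

variable {Ω : Type*} [MeasurableSpace Ω] {P : Measure Ω} {X : ℝ → Ω → ℝ} {C : ℝ → ℝ}
  {μ : Measure ℝ} {K : ℝ}

lemma exists_continuous_modification (h : IsStationaryGaussian X P C) :
    ∃ Y : ℝ → Ω → ℝ, IsStationaryGaussian Y P C ∧ (∀ ω, Continuous fun t => Y t ω) ∧
      ∀ᵐ ω ∂P, ∀ t, X t ω = Y t ω := by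
  -- The path is replaced by zero on a measurable null set containing all discontinuous paths.
  obtain ⟨N, hN, hNm, hN0⟩ := exists_measurable_superset_of_null (ae_iff.1 h.continuous_paths)
  have hae : ∀ᵐ ω ∂P, ∀ t, X t ω = Nᶜ.indicator (X t) ω := by
    filter_upwards [measure_eq_zero_iff_ae_notMem.1 hN0] with ω hω t
    rw [Set.indicator_of_mem hω]
  have hcont : ∀ ω, Continuous fun t => Nᶜ.indicator (X t) ω := by
    intro ω
    by_cases hω : ω ∈ N
    · simpa [hω] using continuous_const
    · have := not_not.1 fun hc => hω (hN hc)
      simpa [hω] using this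
  have haet : ∀ t, X t =ᵐ[P] Nᶜ.indicator (X t) := fun t => hae.mono fun ω hω => hω t
  refine ⟨fun t => Nᶜ.indicator (X t), ⟨fun t => (h.measurable t).indicator hNm.compl,
    h.gaussian.congr haet, fun t => ?_, fun s t => ?_, Eventually.of_forall hcont⟩, hcont, hae⟩
  · rw [← integral_congr_ae (haet t), h.centred]
  · rw [← h.covariance_eq, covariance, covariance, integral_congr_ae (haet s),
      integral_congr_ae (haet t)]
    refine integral_congr_ae ?_
    filter_upwards [hae] with ω hω
    rw [hω s, hω t]

lemma ae_isLocallyFiniteSet_zeroSet (h : IsStationaryGaussian X P C) (hC : IsSpectralMeasure μ C)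
    (hK0 : 0 ≤ K) (hK : ∀ u, 1 - C u ^ 2 ≤ K ^ 2 * u ^ 2) :
    ∀ᵐ ω ∂P, IsLocallyFiniteSet (zeroSet X ω) := by
  obtain ⟨Y, hY, hYc, hXY⟩ := h.exists_continuous_modification
  have hfin : ∀ᵐ ω ∂P, ∀ N : ℕ, (zeroSet Y ω ∩ Set.Ico (-(N : ℝ)) N).encard ≠ ⊤ := by
    rw [ae_all_iff]
    intro N
    rcases N.eq_zero_or_pos with rfl | hN
    · simp
    · have hN' : (0 : ℝ) < N := by exact_mod_cast hN
      exact measure_eq_zero_iff_ae_notMem.1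
        (hY.measure_encard_eq_top hC hYc hK0 hK (by linarith))
  filter_upwards [hfin, hXY] with ω hω hXYω
  have : zeroSet X ω = zeroSet Y ω := by simp [zeroSet, hXYω]
  rw [this]
  exact isLocallyFiniteSet_iff_encard.2 hω

theorem isWeaklyMixingPointProcess (h : IsStationaryGaussian X P C)
    (hmix : IsWeaklyMixingProcess X P) : IsWeaklyMixingPointProcess (zeroConfiguration X) P := by
  have hprob := h.gaussian.isProbabilityMeasure
  obtain ⟨Y, hY, hYc, hXY⟩ := h.exists_continuous_modification
  have haem : ∀ t, AEMeasurable (fun ω => (zeroConfiguration X ω).translate t) P := by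
    intro t
    refine ⟨zeroConfiguration fun s => Y (s - t), measurable_zeroConfiguration
      (fun s => hY.measurable _) (fun ω => (hYc ω).comp (continuous_sub_right t)), ?_⟩
    filter_upwards [hXY] with ω hω
    rw [translate_zeroConfiguration]
    exact zeroConfiguration_congr fun s => hω _
  have hZ : AEMeasurable (zeroConfiguration X) P := by
    refine ⟨zeroConfiguration Y, measurable_zeroConfiguration hY.measurable hYc, ?_⟩
    filter_upwards [hXY] with ω hω
    exact zeroConfiguration_congr hω
  have hpath := h.measurable_path
  have hshift : ∀ t, Measurable fun ω s => X (s + t) ω := fun t =>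
    (measurable_pathShift t).comp hpath
  have hstat : ∀ t {S : Set (ℝ → ℝ)}, MeasurableSet S →
      P {ω | (fun s => X (s + t) ω) ∈ S} = P {ω | (fun s => X s ω) ∈ S} := by
    intro t S hS
    have := congrArg (fun m => m S) (hmix.stationary t)
    simpa only [Measure.map_apply (hshift t) hS, Measure.map_apply hpath hS] using! this
  refine ⟨hZ, fun t => ?_, fun A B hA hB => ?_⟩
  · ext A hA
    obtain ⟨A', hA', hAA'⟩ := exists_measurableSet_zeroConfiguration_iff hA
    rw [Measure.map_apply_of_aemeasurable (haem t) hA, Measure.map_apply_of_aemeasurable hZ hA]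
    have h1 : P ((fun ω => (zeroConfiguration X ω).translate t) ⁻¹' A)
        = P {ω | (fun s => X (s + -t) ω) ∈ A'} := by
      refine measure_congr ?_
      filter_upwards [h.continuous_paths] with ω hω
      refine propext ?_
      change (zeroConfiguration X ω).translate t ∈ A ↔ (fun s => X (s + -t) ω) ∈ A'
      rw [translate_zeroConfiguration, hAA' Ω (fun s => X (s - t)) ω
        (hω.comp (continuous_sub_right t))]
      rfl
    have h2 : P (zeroConfiguration X ⁻¹' A) = P {ω | (fun s => X s ω) ∈ A'} := by
      refine measure_congr ?_
      filter_upwards [h.continuous_paths] with ω hω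
      exact propext (hAA' Ω X ω hω)
    rw [h1, h2, hstat _ hA']
  · obtain ⟨A', hA', hAA'⟩ := exists_measurableSet_zeroConfiguration_iff hA
    obtain ⟨B', hB', hBB'⟩ := exists_measurableSet_zeroConfiguration_iff hB
    have h1 : P.real {ω | zeroConfiguration X ω ∈ A} = P.real {ω | (fun s => X s ω) ∈ A'} := by
      refine measureReal_congr ?_
      filter_upwards [h.continuous_paths] with ω hω
      exact propext (hAA' Ω X ω hω)
    have h2 : P.real {ω | zeroConfiguration X ω ∈ B} = P.real {ω | (fun s => X s ω) ∈ B'} := by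
      refine measureReal_congr ?_
      filter_upwards [h.continuous_paths] with ω hω
      exact propext (hBB' Ω X ω hω)
    -- Translating the zeros by `t` shifts the path by `-t`. By stationarity the pair `(X, X(· -
    -- t))` has the law of `(X(· + t), X)`, so `A'` and `B'` exchange roles.
    have h3 : ∀ t, P.real {ω | zeroConfiguration X ω ∈ A ∧ (zeroConfiguration X ω).translate t ∈ B}
        = P.real {ω | (fun s => X s ω) ∈ B' ∧ (fun s => X (s + t) ω) ∈ A'} := by
      intro t
      have h4 : P.real {ω | zeroConfiguration X ω ∈ A ∧ (zeroConfiguration X ω).translate t ∈ B}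
          = P.real {ω | (fun s => X s ω) ∈ A' ∩ pathShift (-t) ⁻¹' B'} := by
        refine measureReal_congr ?_
        filter_upwards [h.continuous_paths] with ω hω
        refine propext (and_congr (hAA' Ω X ω hω) ?_)
        change (zeroConfiguration X ω).translate t ∈ B ↔ (fun s => X (s + -t) ω) ∈ B'
        rw [translate_zeroConfiguration, hBB' Ω (fun s => X (s - t)) ω
          (hω.comp (continuous_sub_right t))]
        rfl
      rw [h4, measureReal_def, measureReal_def,
        ← hstat t (hA'.inter (hB'.preimage (measurable_pathShift (-t))))]
      congr 2
      ext ω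
      have hback : pathShift (-t) (fun s => X (s + t) ω) = fun s => X s ω :=
        funext fun s => by simp [pathShift]
      simp [hback, and_comm]
    simp_rw [h1, h2, h3, mul_comm (P.real {ω | (fun s => X s ω) ∈ A'})]
    exact hmix.mixing B' A' hB' hA'

end IsStationaryGaussian

/-! ### The covariance of the symmetric Bernoulli convolution -/

lemma isSpectralMeasure_bernoulliConvolution {lam : ℕ → ℝ} (hsum : Summable lam) :
    IsSpectralMeasure (bernoulliConvolution lam) (bernoulliCov lam) :=
  ⟨isProbabilityMeasure_bernoulliConvolution hsum, charFun_bernoulliConvolution hsum⟩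

/-- The signed sums are bounded by `M`, so `cos x ≥ 1 - x ^ 2 / 2` gives `1 - C u ≤ M ^ 2 * u ^ 2 /
2`. Then `1 - C ^ 2 ≤ 2 * (1 - C)`. -/
lemma one_sub_bernoulliCov_sq_le {lam : ℕ → ℝ} (hsum : Summable lam) (u : ℝ) :
    1 - bernoulliCov lam u ^ 2 ≤ (∑' k, |lam k|) ^ 2 * u ^ 2 := by
  have hs := isSpectralMeasure_bernoulliConvolution hsum
  have hm := measurable_bernoulliSum hsum
  set M := ∑' k, |lam k|
  have heq : bernoulliCov lam u = ∫ e, Real.cos (u * bernoulliSum lam e) ∂coinTossing := by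
    rw [hs.eq_integral_cos, bernoulliConvolution, integral_map hm.aemeasurable (by fun_prop)]
  have hint : Integrable (fun e => Real.cos (u * bernoulliSum lam e)) coinTossing :=
    Integrable.of_bound (C := 1) (Real.measurable_cos.comp (hm.const_mul u)).aestronglyMeasurable
      (Eventually.of_forall fun e => Real.abs_cos_le_one _)
  have hle : 1 - M ^ 2 * u ^ 2 / 2 ≤ bernoulliCov lam u := by
    rw [heq]
    calc 1 - M ^ 2 * u ^ 2 / 2 = ∫ _, (1 - M ^ 2 * u ^ 2 / 2) ∂coinTossing := by simp
      _ ≤ _ := by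
        refine integral_mono (integrable_const _) hint fun e => ?_
        refine le_trans ?_ Real.one_sub_sq_div_two_le_cos
        have h1 := sq_le_sq.2 ((abs_bernoulliSum_le hsum e).trans (le_abs_self M))
        rw [mul_pow]
        nlinarith [sq_nonneg u]
  have h1 := abs_le.1 (hs.abs_le_one u)
  nlinarith

theorem mainTheorem5 (lam : ℕ → ℝ) (hsum : Summable lam)
    (hlam : ∀ n, tailSum lam n < lam n ∧ 0 < tailSum lam n) :
    (∀ t : ℝ, charFun (bernoulliConvolution lam) t = (bernoulliCov lam t : ℂ)) ∧
    (∀ x : ℝ, bernoulliConvolution lam {x} = 0) ∧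
    IsCantorType (bernoulliConvolution lam).support ∧
    CesaroTendstoZero (bernoulliCov lam) ∧
    ∀ (Ω : Type*) [MeasurableSpace Ω] (P : Measure Ω) [IsProbabilityMeasure P] (X : ℝ → Ω → ℝ),
      IsStationaryGaussian X P (bernoulliCov lam) →
        IsWeaklyMixingProcess X P ∧
        (∀ᵐ ω ∂P, IsLocallyFiniteSet (zeroSet X ω)) ∧
        IsWeaklyMixingPointProcess (zeroConfiguration X) P := by
  have hs := isSpectralMeasure_bernoulliConvolution hsum
  have hatom := bernoulliConvolution_singleton hsum hlam
  refine ⟨hs.charFun_eq, hatom, isCantorType_support_bernoulliConvolution hsum hlam,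
    hs.cesaroTendstoZero (hatom 0), fun Ω _ P _ X hX => ?_⟩
  have hmix := hX.isWeaklyMixingProcess hs.abs_le_one (hs.isMeanNull hatom)
  exact ⟨hmix, hX.ae_isLocallyFiniteSet_zeroSet hs (tsum_nonneg fun k => abs_nonneg (lam k))
    (one_sub_bernoulliCov_sq_le hsum), hX.isWeaklyMixingPointProcess hmix⟩
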